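/- Let $M$ be a convenient ($c^\infty$-complete, Kriegl–Michor) manifold modelled on a convenient vector space $\mathbb{E}$, with kinematic tangent bundle $TM$ and kinematic cotangent bundle $T'M$. Let $\mathbb{E}^\flat$ be a linear subspace of the bornological dual $\mathbb{E}'$, endowed with its own convenient structure such that the inclusion $\mathbb{E}^\flat\to\mathbb{E}'$ is bounded, and let $T^\flat M\subseteq T'M$ be a weak subbundle with typical fibre $\mathbb{E}^\flat$: around each point there is a chart $U\cong\phi(U)\subseteq\mathbb{E}$ of $M$ in which the inclusion $T^\flat M\subseteq T'M$ corresponds to $\phi(U)\times\mathbb{E}^\flat\subseteq \phi(U)\times\mathbb{E}'$ (call such charts adapted), and the induced changes of coordinates on $\mathbb{E}^\flat$ between such charts are smooth. For $U\subseteq M$ open, let $\mathfrak{A}(U)$ be the set of $f\in C^\infty(U)$ such that, in adapted charts and for every $k\ge1$, $d^k_xf(\cdot,u_2,\dots,u_k)\in T^\flat_xM$ for all $x\in U$ and $u_2,\dots,u_k\in T_xM$, the resulting map $(x,u_2,\dots,u_k)\mapsto d^k_xf(\cdot,u_2,\dots,u_k)$ into $T^\flat M$ being smooth. Let $\mathfrak{P}$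 be the sheaf of $\mathfrak{A}$-modules of sections of $T^\flat M$ generated by the differentials $df$, $f\in\mathfrak{A}(U)$. An almost Poisson anchor is a smooth bundle morphism $P:T^\flat M\to TM$ over $\mathrm{id}_M$ with $\langle\xi,P\eta\rangle=-\langle\eta,P\xi\rangle$ for all $\xi,\eta\in T^\flat_xM$, $x\in M$. For $f\in\mathfrak{A}(U)$ and $g\in C^\infty(U)$ put $\{f,g\}_P=\langle dg,P(df)\rangle$ (so $\{f,g\}_P=-\langle df,P(dg)\rangle$ if also $g\in\mathfrak{A}(U)$). $P$ is a partial Poisson anchor if moreover, for every open $U\subseteq M$ and all $f,g,h\in\mathfrak{A}(U)$, $$\{f,\{g,h\}_P\}_P+\{g,\{h,f\}_P\}_P+\{h,\{f,g\}_P\}_P=0 .$$ For almost Poisson anchors $P,Q:T^\flat M\to TM$ the Schouten bracket $[\tilde P,\tilde Q]$ is the tensor given, for $\sigma_1,\sigma_2,\sigma_3\in\mathfrak{P}(U)$, by $$[\tilde P,\tilde Q](\sigma_1,\sigma_2,\sigma_3)=\sum_{\mathrm{cyc}(1,2,3)}\Big(\langle L_{P\sigma_1}\sigma_2,Q\sigma_3\rangle+\langle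 L_{Q\sigma_1}\sigma_2,P\sigma_3\rangle\Big),\qquad \langle L_X\sigma,Y\rangle=X\langle\sigma,Y\rangle-\langle\sigma,[X,Y]\rangle .$$ Theorem. Let $P,Q:T^\flat M\to TM$ be two partial Poisson anchors. Then $P$ and $Q$ are compatible, i.e. $P+Q$ is again a partial Poisson anchor, if and only if $[\tilde P,\tilde Q]=0$, i.e. $[\tilde P,\tilde Q](\sigma_1,\sigma_2,\sigma_3)=0$ on $U$ for every open $U\subseteq M$ and all $\sigma_1,\sigma_2,\sigma_3\in\mathfrak{P}(U)$. -/

import Mathlib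

open Set Filter Topology

/-! ## Convenient calculus -/

/-- A convenient (`c^∞`-complete) vector space: a Hausdorff locally convex real topological vector
space in which every Mackey-Cauchy sequence converges. -/
class ConvenientSpace (E : Type*) [AddCommGroup E] [Module ℝ E] [TopologicalSpace E] : Prop
    extends IsTopologicalAddGroup E, ContinuousSMul ℝ E, LocallyConvexSpace ℝ E, T2Space E where
  mackey_complete : ∀ x : ℕ → E,
    (∃ B : Set E, Bornology.IsVonNBounded ℝ B ∧ AbsConvex ℝ B ∧
      ∀ ε : ℝ, 0 < ε → ∃ N : ℕ, ∀ n m : ℕ, N < m → m < n → ∃ b ∈ B, x m - x n = ε • b) →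
    ∃ l : E, Tendsto x atTop (𝓝 l)

section Calculus

variable {E : Type*} [AddCommGroup E] [Module ℝ E] [TopologicalSpace E]
variable {F : Type*} [AddCommGroup F] [Module ℝ F] [TopologicalSpace F]

/-- A curve `c : ℝ → E` is smooth if all its iterated derivatives exist (the sequence `d` lists
them, derivatives being limits of difference quotients in `E`). -/
def SmoothCurve (c : ℝ → E) : Prop :=
  ∃ d : ℕ → ℝ → E, d 0 = c ∧
    ∀ (n : ℕ) (t : ℝ),
      Tendsto (fun h : ℝ => h⁻¹ • (d n (t + h) - d n t)) (𝓝[≠] 0) (𝓝 (d (n + 1) t))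

/-- Open sets of the `c^∞`-topology, the final topology for all smooth curves `ℝ → E`. -/
def CInftyOpen (U : Set E) : Prop :=
  ∀ c : ℝ → E, SmoothCurve c → IsOpen (c ⁻¹' U)

/-- `f` is (conveniently) smooth on the `c^∞`-open set `U`: it maps smooth curves in `U` to smooth
curves. -/
def CSmoothOn (U : Set E) (f : E → F) : Prop :=
  ∀ c : ℝ → E, SmoothCurve c → (∀ t, c t ∈ U) → SmoothCurve (f ∘ c)

/-- The differential `df(x)v = lim_{t → 0} (f(x + t v) - f(x)) / t`. -/
noncomputable def cdiff (f : E → F) (x v : E) : F :=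
  limUnder (𝓝[≠] (0 : ℝ)) (fun t : ℝ => t⁻¹ • (f (x + t • v) - f x))

/-- The iterated differential `d^k f(x)(u_0, …, u_{k-1})`. -/
noncomputable def iteratedCdiff (f : E → ℝ) : (k : ℕ) → E → (Fin k → E) → ℝ
  | 0, x, _ => f x
  | k + 1, x, u => cdiff (fun y => iteratedCdiff f k y (Fin.tail u)) x (u 0)

end Calculus

/-! ## Convenient manifolds -/

section Manifold

variable {E : Type*} [AddCommGroup E] [Module ℝ E] [TopologicalSpace E]
variable {M : Type*}

/-- The change of charts `e' ∘ e⁻¹` is a smooth map defined on a `c^∞`-open subset of `E`. -/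
def SmoothTransition (e e' : PartialEquiv M E) : Prop :=
  CInftyOpen (e.symm.trans e').source ∧ CSmoothOn (e.symm.trans e').source (e' ∘ e.symm)

variable (E M) in
/-- A convenient manifold: a set `M` with a smooth atlas modelled on the convenient space `E`. -/
structure ConvenientManifold where
  atlas : Set (PartialEquiv M E)
  cover : ∀ x : M, ∃ e ∈ atlas, x ∈ e.source
  target_open : ∀ e ∈ atlas, CInftyOpen e.target
  compatible : ∀ e ∈ atlas, ∀ e' ∈ atlas, SmoothTransition e e'

/-- All the charts that are compatible with the atlas. -/
def ConvenientManifold.maximalAtlas (𝓜 : ConvenientManifold E M) : Set (PartialEquiv M E) :=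
  {e | CInftyOpen e.target ∧ ∀ a ∈ 𝓜.atlas, SmoothTransition e a ∧ SmoothTransition a e}

/-- Open subsets of `M`, for the topology that makes the charts homeomorphisms onto `c^∞`-open
sets. -/
def ConvenientManifold.IsOpenSet (𝓜 : ConvenientManifold E M) (U : Set M) : Prop :=
  ∀ e ∈ 𝓜.atlas, CInftyOpen (e.target ∩ e.symm ⁻¹' U)

/-- `f ∈ C^∞(U)` (only the values of `f` on `U` matter). -/
def ConvenientManifold.SmoothFun (𝓜 : ConvenientManifold E M) (U : Set M) (f : M → ℝ) : Prop :=
  ∀ e ∈ 𝓜.atlas, CSmoothOn (e.target ∩ e.symm ⁻¹' U) (f ∘ e.symm)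

end Manifold

/-! ## Weak subbundles of the kinematic cotangent bundle -/

section Bundle

variable {E : Type*} [AddCommGroup E] [Module ℝ E] [TopologicalSpace E]
variable {F : Type*} [AddCommGroup F] [Module ℝ F] [TopologicalSpace F]
variable {M : Type*}

variable (F) in
/-- A weak subbundle `T^♭M → M` of the kinematic cotangent bundle `T'M → M`.

Its typical fibre `F = E^♭` is a linear subspace of the bornological dual `E'`, with its own
convenient structure and with bounded inclusion `F → E'`: this is recorded by the duality pairing
`F × E → ℝ`, which is nondegenerate on the left and bounded.  Around each point there is a chart
`e` of `M` in which the inclusion `T^♭M ⊆ T'M` reads `e.target × F ⊆ e.target × E'`, and the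
changes of coordinates of `T'M` between two such charts restrict to smooth changes of coordinates
of `T^♭M`. -/
structure WeakSubbundle (𝓜 : ConvenientManifold E M) where
  pairing : F →ₗ[ℝ] E →ₗ[ℝ] ℝ
  pairing_injective : Function.Injective pairing
  pairing_bounded : ∀ (A : Set F) (B : Set E), Bornology.IsVonNBounded ℝ A →
    Bornology.IsVonNBounded ℝ B → ∃ C : ℝ, ∀ ξ ∈ A, ∀ v ∈ B, |pairing ξ v| ≤ C
  charts : Set (PartialEquiv M E)
  charts_subset : charts ⊆ 𝓜.maximalAtlas
  cover : ∀ x : M, ∃ e ∈ charts, x ∈ e.source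
  transition : ∀ e ∈ charts, ∀ e' ∈ charts, ∃ τ : E × F → F,
    CSmoothOn ((e.symm.trans e').source ×ˢ univ) τ ∧
    ∀ y ∈ (e.symm.trans e').source, ∀ (ξ : F) (v : E),
      pairing (τ (y, ξ)) v = pairing ξ (cdiff (e' ∘ e.symm) y v)

namespace WeakSubbundle

variable {𝓜 : ConvenientManifold E M} (T : WeakSubbundle F 𝓜)

/-- A chosen chart around `x` adapted to `T^♭M`.  It identifies the kinematic tangent space `T_xM`
with `E` and the fibre `T^♭_xM` with `F`; elements of these fibres are given below by
their coordinates in this chart. -/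
noncomputable def chartAt (x : M) : PartialEquiv M E := Classical.choose (T.cover x)

/-- The element of `F` that represents the linear form `ℓ` (when `ℓ` lies in `F ⊆ E'`). -/
noncomputable def lift (ℓ : E → ℝ) : F :=
  Function.invFun (fun (ξ : F) (v : E) => T.pairing ξ v) ℓ

/-- The tangent map `T_xM → E` of a chart `e`, that is, the coordinates in `e` of `v ∈ T_xM`. -/
noncomputable def tangentCoord (e : PartialEquiv M E) (x : M) (v : E) : E :=
  cdiff (e ∘ (T.chartAt x).symm) (T.chartAt x x) v

/-- The element of `T^♭_xM` whose coordinates in the adapted chart `e` are `ξ`. -/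
noncomputable def cotangentOfCoord (e : PartialEquiv M E) (x : M) (ξ : F) : F :=
  T.lift (fun v => T.pairing ξ (T.tangentCoord e x v))

/-- The derivative `d_xf(v)` of a function on `M` in the direction `v ∈ T_xM`. -/
noncomputable def dfun (f : M → ℝ) (x : M) (v : E) : ℝ :=
  cdiff (f ∘ (T.chartAt x).symm) (T.chartAt x x) v

/-- `d_xf` as an element of `T^♭_xM` (when it belongs to it). -/
noncomputable def dflat (f : M → ℝ) (x : M) : F := T.lift (T.dfun f x)

/-- The set `𝔄(U)` of the `f ∈ C^∞(U)` such that, for each `k ≥ 1`, the form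
`d^k_xf(·, u_2, …, u_k)` belongs to `T^♭_xM`, smoothly in `(x, u_2, …, u_k)`; derivatives are
taken in the adapted charts. -/
def InA (U : Set M) (f : M → ℝ) : Prop :=
  𝓜.SmoothFun U f ∧
    ∀ e ∈ T.charts, ∀ k : ℕ, ∃ G : E × (Fin k → E) → F,
      CSmoothOn ((e.target ∩ e.symm ⁻¹' U) ×ˢ univ) G ∧
      ∀ y ∈ e.target ∩ e.symm ⁻¹' U, ∀ (u : Fin k → E) (v : E),
        T.pairing (G (y, u)) v = iteratedCdiff (f ∘ e.symm) (k + 1) y (Fin.cons v u)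

/-- Sections over `U` of the sheaf `𝔓` of `𝔄`-modules generated by the `df`, `f ∈ 𝔄`: sections of
`T^♭M` that are locally finite sums `∑ a_i df_i` with `a_i` and `f_i` in `𝔄`. -/
def InP (U : Set M) (σ : M → F) : Prop :=
  ∀ x ∈ U, ∃ W : Set M, 𝓜.IsOpenSet W ∧ x ∈ W ∧ W ⊆ U ∧
    ∃ (n : ℕ) (a f : Fin n → M → ℝ), (∀ i, T.InA W (a i)) ∧ (∀ i, T.InA W (f i)) ∧
      ∀ y ∈ W, σ y = ∑ i, a i y • T.dflat (f i) y

/-! ### Anchors -/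

/-- An almost Poisson anchor `P : T^♭M → TM`: a smooth bundle morphism (its expression in each
adapted chart is smooth) that is antisymmetric, `⟨ξ, P η⟩ = -⟨η, P ξ⟩`. -/
def IsAlmostPoissonAnchor (P : M → F →ₗ[ℝ] E) : Prop :=
  (∀ e ∈ T.charts, CSmoothOn (e.target ×ˢ (univ : Set F))
    (fun p : E × F =>
      T.tangentCoord e (e.symm p.1) (P (e.symm p.1) (T.cotangentOfCoord e (e.symm p.1) p.2)))) ∧
  ∀ (x : M) (ξ η : F), T.pairing ξ (P x η) = - T.pairing η (P x ξ)

/-- The bracket `{f, g}_P = ⟨dg, P(df)⟩`, for `f ∈ 𝔄(U)` and `g ∈ C^∞(U)`.  For `f, g ∈ 𝔄(U)` and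
`P` antisymmetric it equals `-⟨df, P(dg)⟩`. -/
noncomputable def bracket (P : M → F →ₗ[ℝ] E) (f g : M → ℝ) : M → ℝ :=
  fun x => T.dfun g x (P x (T.dflat f x))

/-- A partial Poisson anchor: an almost Poisson anchor whose bracket satisfies the Jacobi identity
on `𝔄(U)`, for every open subset `U` of `M`. -/
def IsPartialPoissonAnchor (P : M → F →ₗ[ℝ] E) : Prop :=
  T.IsAlmostPoissonAnchor P ∧
  ∀ U : Set M, 𝓜.IsOpenSet U → ∀ f g h : M → ℝ, T.InA U f → T.InA U g → T.InA U h →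
    ∀ x ∈ U,
      T.bracket P f (T.bracket P g h) x + T.bracket P g (T.bracket P h f) x
        + T.bracket P h (T.bracket P f g) x = 0

/-- Two partial Poisson anchors are compatible if their sum is again a partial Poisson anchor. -/
def Compatible (P Q : M → F →ₗ[ℝ] E) : Prop := T.IsPartialPoissonAnchor (P + Q)

/-! ### The Schouten bracket -/

/-- The expression of a vector field `X` in the chart `e`. -/
noncomputable def fieldInChart (e : PartialEquiv M E) (X : M → E) : E → E :=
  fun y => T.tangentCoord e (e.symm y) (X (e.symm y))

/-- The Lie bracket of vector fields, in charts `[X, Y] = dY(X) - dX(Y)`. -/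
noncomputable def lieBracket (X Y : M → E) : M → E := fun x =>
  cdiff (T.fieldInChart (T.chartAt x) Y) (T.chartAt x x) (X x)
    - cdiff (T.fieldInChart (T.chartAt x) X) (T.chartAt x x) (Y x)

/-- `⟨L_X σ, Y⟩ = X(⟨σ, Y⟩) - ⟨σ, [X, Y]⟩`, the Lie derivative of a section `σ` of `T^♭M` along
the vector field `X`, evaluated on the vector field `Y`. -/
noncomputable def lieDerivative (X : M → E) (σ : M → F) (Y : M → E) : M → ℝ := fun x =>
  T.dfun (fun z => T.pairing (σ z) (Y z)) x (X x) - T.pairing (σ x) (T.lieBracket X Y x)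

/-- The vector field `Pσ`. -/
def applySection (P : M → F →ₗ[ℝ] E) (σ : M → F) : M → E := fun x => P x (σ x)

/-- The cyclic summand of the Schouten bracket,
`⟨L_{Pσ₁} σ₂, Qσ₃⟩ + ⟨L_{Qσ₁} σ₂, Pσ₃⟩`. -/
noncomputable def schoutenTerm (P Q : M → F →ₗ[ℝ] E) (σ₁ σ₂ σ₃ : M → F) : M → ℝ := fun x =>
  T.lieDerivative (applySection P σ₁) σ₂ (applySection Q σ₃) x
    + T.lieDerivative (applySection Q σ₁) σ₂ (applySection P σ₃) x

/-- The Schouten bracket `[P̃, Q̃]`, symmetric and bilinear in `(P, Q)`, evaluated on three sections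
of `𝔓`.  For `P = Q` it is twice the cyclic sum of the `⟨L_{Pσ₁} σ₂, Pσ₃⟩`. -/
noncomputable def schouten (P Q : M → F →ₗ[ℝ] E) (σ₁ σ₂ σ₃ : M → F) : M → ℝ := fun x =>
  T.schoutenTerm P Q σ₁ σ₂ σ₃ x + T.schoutenTerm P Q σ₂ σ₃ σ₁ x + T.schoutenTerm P Q σ₃ σ₁ σ₂ x

/-- `[P̃, Q̃] = 0`: the bracket vanishes on all local sections of `𝔓`. -/
def SchoutenVanishes (P Q : M → F →ₗ[ℝ] E) : Prop :=
  ∀ U : Set M, 𝓜.IsOpenSet U → ∀ σ₁ σ₂ σ₃ : M → F, T.InP U σ₁ → T.InP U σ₂ → T.InP U σ₃ →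
    ∀ x ∈ U, T.schouten P Q σ₁ σ₂ σ₃ x = 0

end WeakSubbundle

end Bundle

/-!
In a chart adapted to `T^♭M`, write `DR` for the derivative of an anchor `R`.  The double bracket
`{f, {g, h}_R}_R` is the sum of `⟨dh, DR(R df) dg⟩` and of two terms in which the second derivatives
of `g` and `h` are paired with values of `R`.  As second derivatives are symmetric, these terms
cancel in the cyclic sum, and the Jacobiator of `R` at a point is
`J(R, DR) = ∑_cyc ⟨dh, DR(R df) dg⟩`.  In the same way the antisymmetry of `P` and `Q` cancels the
derivatives of the sections in `[P̃, Q̃]`, and what remains is `J(P, DQ) + J(Q, DP)`, the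
polarization of the quadratic form `J`.  Hence, on functions of `𝔄`, the Jacobiator of `P + Q` is
the sum of those of `P` and `Q` and of `[P̃, Q̃](df, dg, dh)`.  As `J(P, DQ) + J(Q, DP)` is
trilinear in the values of the sections, and the sections of `𝔓` are combinations of differentials,
`[P̃, Q̃]` vanishes as soon as it vanishes on differentials.

Smoothness is tested along smooth curves only, and the calculus behind this rests on one device:
given vectors that tend to zero rapidly, there is a smooth curve through all of them.  A function
which is smooth along curves is therefore continuous along rapidly converging sequences, and this
suffices for the chain rule and for the symmetry of second derivatives.
-/

/-! ### Derivatives of curves -/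

section CurveDerivative

variable {E : Type*} [AddCommGroup E] [Module ℝ E] [TopologicalSpace E]
variable {F : Type*} [AddCommGroup F] [Module ℝ F] [TopologicalSpace F]

/-- The curve `c` has the derivative `v` at `t`, in the sense of difference quotients; this is the
relation between consecutive derivatives in `SmoothCurve`. -/
def HasCurveDeriv (c : ℝ → E) (v : E) (t : ℝ) : Prop :=
  Tendsto (fun h : ℝ => h⁻¹ • (c (t + h) - c t)) (𝓝[≠] 0) (𝓝 v)

lemma hasCurveDeriv_iff_hasDerivAt {c : ℝ → ℝ} {v t : ℝ} :
    HasCurveDeriv c v t ↔ HasDerivAt c v t :=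
  hasDerivAt_iff_tendsto_slope_zero.symm

lemma tendsto_const_add_nhds_zero (t : ℝ) : Tendsto (fun h : ℝ => t + h) (𝓝 0) (𝓝 t) :=
  (continuous_const.add continuous_id).tendsto' 0 t (add_zero t)

/-- Carathéodory's form of the derivative. -/
lemma hasCurveDeriv_iff_exists_slope {c : ℝ → E} {v : E} {t : ℝ} :
    HasCurveDeriv c v t ↔
      ∃ q : ℝ → E, q 0 = v ∧ ContinuousAt q 0 ∧ ∀ h, c (t + h) = c t + h • q h := by
  classical
  constructor
  · intro hc
    refine ⟨Function.update (fun h => h⁻¹ • (c (t + h) - c t)) 0 v, Function.update_self ..,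
      continuousAt_update_same.2 hc, fun h => ?_⟩
    rcases eq_or_ne h 0 with rfl | hh
    · simp
    · rw [Function.update_of_ne hh, smul_inv_smul₀ hh, add_sub_cancel]
  · rintro ⟨q, rfl, hq, h⟩
    refine (hq.tendsto.mono_left nhdsWithin_le_nhds).congr' ?_
    filter_upwards [self_mem_nhdsWithin] with s hs
    rw [h, add_sub_cancel_left, inv_smul_smul₀ hs]

namespace HasCurveDeriv

lemma unique [T2Space E] {c : ℝ → E} {v w : E} {t : ℝ} (hv : HasCurveDeriv c v t)
    (hw : HasCurveDeriv c w t) : v = w :=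
  tendsto_nhds_unique hv hw

lemma congr {c d : ℝ → E} {v : E} {t : ℝ} (hc : HasCurveDeriv c v t) (h : c =ᶠ[𝓝 t] d) :
    HasCurveDeriv d v t := by
  refine Tendsto.congr' ?_ hc
  filter_upwards [nhdsWithin_le_nhds ((tendsto_const_add_nhds_zero t).eventually h)] with s hs
  rw [hs, h.eq_of_nhds]

lemma map {c : ℝ → E} {v : E} {t : ℝ} (hc : HasCurveDeriv c v t) (L : E →L[ℝ] F) :
    HasCurveDeriv (fun s => L (c s)) (L v) t :=
  ((L.continuous.tendsto v).comp hc).congr fun h => by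
    rw [Function.comp_apply, map_smul, map_sub]

lemma prodMk {c : ℝ → E} {v : E} {d : ℝ → F} {w : F} {t : ℝ} (hc : HasCurveDeriv c v t)
    (hd : HasCurveDeriv d w t) : HasCurveDeriv (fun s => (c s, d s)) (v, w) t :=
  hc.prodMk_nhds hd

lemma const (v : E) (t : ℝ) : HasCurveDeriv (fun _ => v) 0 t := by
  simpa only [HasCurveDeriv, sub_self, smul_zero] using tendsto_const_nhds

lemma add [IsTopologicalAddGroup E] {c d : ℝ → E} {v w : E} {t : ℝ} (hc : HasCurveDeriv c v t)
    (hd : HasCurveDeriv d w t) : HasCurveDeriv (fun s => c s + d s) (v + w) t :=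
  (Tendsto.add hc hd).congr fun h => by rw [← smul_add, add_sub_add_comm]

lemma comp [ContinuousSMul ℝ E] {c : ℝ → E} {v : E} {φ : ℝ → ℝ} {a t : ℝ}
    (hc : HasCurveDeriv c v (φ t)) (hφ : HasDerivAt φ a t) :
    HasCurveDeriv (fun s => c (φ s)) (a • v) t := by
  obtain ⟨q, rfl, hq, h⟩ := hasCurveDeriv_iff_exists_slope.1 hc
  obtain ⟨r, rfl, hr, h'⟩ :=
    hasCurveDeriv_iff_exists_slope.1 (hasCurveDeriv_iff_hasDerivAt.2 hφ)
  refine hasCurveDeriv_iff_exists_slope.2 ⟨fun s => r s • q (s • r s),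
    by simp only [zero_smul],
    hr.smul (ContinuousAt.comp (by rwa [zero_smul]) (continuousAt_id.smul hr)),
    fun s => ?_⟩
  rw [h' s, h, smul_smul, smul_eq_mul]

variable [IsTopologicalAddGroup E] [ContinuousSMul ℝ E]

lemma continuousAt {c : ℝ → E} {v : E} {t : ℝ} (hc : HasCurveDeriv c v t) : ContinuousAt c t := by
  obtain ⟨q, -, hq, h⟩ := hasCurveDeriv_iff_exists_slope.1 hc
  have hcont : ContinuousAt (fun s => c t + (s - t) • q (s - t)) t := by
    have hq' : ContinuousAt (fun s => q (s - t)) t :=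
      ContinuousAt.comp (by rwa [sub_self]) (by fun_prop)
    exact continuousAt_const.add (ContinuousAt.smul (by fun_prop) hq')
  refine hcont.congr (Eventually.of_forall fun s => ?_)
  simp only [← h, add_sub_cancel]

lemma smul {φ : ℝ → ℝ} {c : ℝ → E} {a : ℝ} {v : E} {t : ℝ} (hφ : HasDerivAt φ a t)
    (hc : HasCurveDeriv c v t) : HasCurveDeriv (fun s => φ s • c s) (a • c t + φ t • v) t := by
  have hct : Tendsto (fun h => c (t + h)) (𝓝[≠] 0) (𝓝 (c t)) :=
    (hc.continuousAt.tendsto.comp (tendsto_const_add_nhds_zero t)).mono_left nhdsWithin_le_nhds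
  refine (Tendsto.add (Tendsto.smul (hasCurveDeriv_iff_hasDerivAt.2 hφ) hct)
    (Tendsto.const_smul hc (φ t))).congr fun h => ?_
  simp only [smul_eq_mul, sub_smul, smul_sub, smul_smul, mul_sub, mul_comm (φ t)]
  abel

lemma smul_const {φ : ℝ → ℝ} {a t : ℝ} (hφ : HasDerivAt φ a t) (v : E) :
    HasCurveDeriv (fun s => φ s • v) (a • v) t := by
  simpa only [smul_zero, add_zero] using smul hφ (const v t)

end HasCurveDeriv

end CurveDerivative

/-! ### Smooth curves -/

section SmoothCurves

variable {E : Type*} [AddCommGroup E] [Module ℝ E] [TopologicalSpace E]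
variable {F : Type*} [AddCommGroup F] [Module ℝ F] [TopologicalSpace F]

/-- The smooth curves form the largest class of curves that is closed under differentiation. -/
lemma smoothCurve_of_mem {S : Set (ℝ → E)}
    (hS : ∀ c ∈ S, ∃ c' ∈ S, ∀ t, HasCurveDeriv c (c' t) t) {c : ℝ → E} (hc : c ∈ S) :
    SmoothCurve c := by
  choose! D hDS hD using hS
  have hmem (n : ℕ) : D^[n] c ∈ S := by
    induction n with
    | zero => exact hc
    | succ n ih => rw [Function.iterate_succ_apply']; exact hDS _ ih
  refine ⟨fun n => D^[n] c, rfl, fun n t => ?_⟩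
  simpa only [Function.iterate_succ_apply', HasCurveDeriv] using hD _ (hmem n) t

lemma smoothCurve_of_contDiff {φ : ℝ → ℝ} (hφ : ContDiff ℝ (⊤ : ℕ∞) φ) : SmoothCurve φ :=
  smoothCurve_of_mem (S := {φ | ContDiff ℝ (⊤ : ℕ∞) φ})
    (fun φ hφ => ⟨deriv φ, (contDiff_infty_iff_deriv.1 hφ).2, fun t =>
      hasCurveDeriv_iff_hasDerivAt.2 ((contDiff_infty_iff_deriv.1 hφ).1 t).hasDerivAt⟩) hφ

lemma smoothCurve_const (v : E) : SmoothCurve (fun _ : ℝ => v) :=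
  smoothCurve_of_mem (S := range fun (v : E) (_ : ℝ) => v)
    (forall_mem_range.2 fun v => ⟨_, mem_range_self 0, HasCurveDeriv.const v⟩) (mem_range_self v)

namespace SmoothCurve

lemma exists_deriv {c : ℝ → E} (hc : SmoothCurve c) :
    ∃ c' : ℝ → E, SmoothCurve c' ∧ ∀ t, HasCurveDeriv c (c' t) t := by
  obtain ⟨d, rfl, hd⟩ := hc
  exact ⟨d 1, ⟨fun n => d (n + 1), rfl, fun n => hd (n + 1)⟩, hd 0⟩

lemma map {c : ℝ → E} (hc : SmoothCurve c) (L : E →L[ℝ] F) : SmoothCurve (fun t => L (c t)) := by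
  obtain ⟨d, rfl, hd⟩ := hc
  exact ⟨fun n t => L (d n t), rfl, fun n t => HasCurveDeriv.map (hd n t) L⟩

lemma prodMk {c : ℝ → E} {d : ℝ → F} (hc : SmoothCurve c) (hd : SmoothCurve d) :
    SmoothCurve (fun t => (c t, d t)) := by
  obtain ⟨c, rfl, hc⟩ := hc
  obtain ⟨d, rfl, hd⟩ := hd
  exact ⟨fun n t => (c n t, d n t), rfl, fun n t => HasCurveDeriv.prodMk (hc n t) (hd n t)⟩

lemma add [IsTopologicalAddGroup E] {c d : ℝ → E} (hc : SmoothCurve c) (hd : SmoothCurve d) :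
    SmoothCurve (fun t => c t + d t) := by
  obtain ⟨c, rfl, hc⟩ := hc
  obtain ⟨d, rfl, hd⟩ := hd
  exact ⟨fun n t => c n t + d n t, rfl, fun n t => HasCurveDeriv.add (hc n t) (hd n t)⟩

end SmoothCurve

lemma smoothCurve_of_mem_of_deriv_mem_closure [IsTopologicalAddGroup E] {S : Set (ℝ → E)}
    (hS : ∀ c ∈ S, ∃ c' ∈ AddSubmonoid.closure S, ∀ t, HasCurveDeriv c (c' t) t) {c : ℝ → E}
    (hc : c ∈ S) : SmoothCurve c := by
  refine smoothCurve_of_mem (S := AddSubmonoid.closure S) (fun c hc => ?_)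
    (AddSubmonoid.subset_closure hc)
  induction hc using AddSubmonoid.closure_induction with
  | mem c hc => exact hS c hc
  | zero => exact ⟨0, zero_mem _, HasCurveDeriv.const 0⟩
  | add c d _ _ ihc ihd =>
    obtain ⟨c', hc'S, hc'⟩ := ihc
    obtain ⟨d', hd'S, hd'⟩ := ihd
    exact ⟨c' + d', add_mem hc'S hd'S, fun t => (hc' t).add (hd' t)⟩

namespace SmoothCurve

variable [IsTopologicalAddGroup E] [ContinuousSMul ℝ E]

lemma continuous {c : ℝ → E} (hc : SmoothCurve c) : Continuous c := by
  obtain ⟨c', -, h⟩ := hc.exists_deriv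
  exact continuous_iff_continuousAt.2 fun t => (h t).continuousAt

lemma exists_seminorm_le {c : ℝ → E} (hc : SmoothCurve c) {p : Seminorm ℝ E} (hp : Continuous p)
    {S : Set ℝ} (hS : IsCompact S) : ∃ C, ∀ t ∈ S, p (c t) ≤ C := by
  simpa only [bddAbove_def, forall_mem_image, Function.comp_apply] using
    hS.bddAbove_image (hp.comp hc.continuous).continuousOn

lemma smul {φ : ℝ → ℝ} {c : ℝ → E} (hφ : SmoothCurve φ) (hc : SmoothCurve c) :
    SmoothCurve (fun t => φ t • c t) := by
  let S : Set (ℝ → E) := {b | ∃ (φ : ℝ → ℝ) (c : ℝ → E),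
    SmoothCurve φ ∧ SmoothCurve c ∧ b = fun t => φ t • c t}
  refine smoothCurve_of_mem_of_deriv_mem_closure (S := S) ?_ ⟨φ, c, hφ, hc, rfl⟩
  rintro _ ⟨φ, c, hφ, hc, rfl⟩
  obtain ⟨φ', hφs, hφ'⟩ := hφ.exists_deriv
  obtain ⟨c', hcs, hc'⟩ := hc.exists_deriv
  exact ⟨_, add_mem (AddSubmonoid.subset_closure ⟨φ', c, hφs, hc, rfl⟩)
    (AddSubmonoid.subset_closure ⟨φ, c', hφ, hcs, rfl⟩),
    fun t => (hc' t).smul (hasCurveDeriv_iff_hasDerivAt.1 (hφ' t))⟩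

lemma comp {φ : ℝ → ℝ} {c : ℝ → E} (hc : SmoothCurve c) (hφ : SmoothCurve φ) :
    SmoothCurve (fun t => c (φ t)) := by
  obtain ⟨φ', hφs, hφ'⟩ := hφ.exists_deriv
  let S : Set (ℝ → E) := {b | ∃ (ψ : ℝ → ℝ) (c : ℝ → E),
    SmoothCurve ψ ∧ SmoothCurve c ∧ b = fun t => ψ t • c (φ t)}
  refine smoothCurve_of_mem_of_deriv_mem_closure (S := S) ?_
    ⟨fun _ => 1, c, smoothCurve_const 1, hc, by simp only [one_smul]⟩
  rintro _ ⟨ψ, c, hψ, hc, rfl⟩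
  obtain ⟨ψ', hψs, hψ'⟩ := hψ.exists_deriv
  obtain ⟨c', hcs, hc'⟩ := hc.exists_deriv
  refine ⟨_, add_mem (AddSubmonoid.subset_closure ⟨ψ', c, hψs, hc, rfl⟩)
    (AddSubmonoid.subset_closure ⟨_, c', hψ.smul hφs, hcs, rfl⟩), fun t => ?_⟩
  have h := ((hc' (φ t)).comp (hasCurveDeriv_iff_hasDerivAt.1 (hφ' t))).smul
    (hasCurveDeriv_iff_hasDerivAt.1 (hψ' t))
  rwa [smul_smul] at h

end SmoothCurve

lemma smoothCurve_line [IsTopologicalAddGroup E] [ContinuousSMul ℝ E] (x v : E) :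
    SmoothCurve (fun t : ℝ => x + t • v) :=
  (smoothCurve_const x).add ((smoothCurve_of_contDiff contDiff_id).smul (smoothCurve_const v))

end SmoothCurves

/-! ### Germs of smooth curves -/

section SmoothCurveGerms

variable {E : Type*} [AddCommGroup E] [Module ℝ E] [TopologicalSpace E]
variable {F : Type*} [AddCommGroup F] [Module ℝ F] [TopologicalSpace F]

/-- Near `t`, the curve `c` agrees with a smooth curve defined on the whole line. -/
def SmoothCurveAt (c : ℝ → E) (t : ℝ) : Prop := ∃ d : ℝ → E, SmoothCurve d ∧ d =ᶠ[𝓝 t] c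

lemma SmoothCurve.smoothCurveAt {c : ℝ → E} (hc : SmoothCurve c) (t : ℝ) : SmoothCurveAt c t :=
  ⟨c, hc, EventuallyEq.rfl⟩

lemma smoothCurve_of_forall_smoothCurveAt [T2Space E] {c : ℝ → E}
    (hc : ∀ t, SmoothCurveAt c t) : SmoothCurve c := by
  refine smoothCurve_of_mem (S := {c | ∀ t, SmoothCurveAt c t}) (fun c hc => ?_) hc
  choose d hd hdc using hc
  choose d' hd's hd' using fun t => (hd t).exists_deriv
  have hderiv (t : ℝ) : HasCurveDeriv c (d' t t) t := (hd' t t).congr (hdc t)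
  refine ⟨fun t => d' t t, fun t => ⟨d' t, hd's t, ?_⟩, hderiv⟩
  filter_upwards [eventually_eventually_nhds.2 (hdc t)] with s hs
  exact ((hd' t s).congr hs).unique (hderiv s)

namespace SmoothCurveAt

lemma congr {c d : ℝ → E} {t : ℝ} (hc : SmoothCurveAt c t) (h : c =ᶠ[𝓝 t] d) :
    SmoothCurveAt d t :=
  let ⟨e, he, hec⟩ := hc
  ⟨e, he, hec.trans h⟩

lemma exists_deriv {c : ℝ → E} {t : ℝ} (hc : SmoothCurveAt c t) : ∃ v, HasCurveDeriv c v t := by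
  obtain ⟨d, hd, h⟩ := hc
  obtain ⟨d', -, hd'⟩ := hd.exists_deriv
  exact ⟨d' t, (hd' t).congr h⟩

lemma continuousAt [IsTopologicalAddGroup E] [ContinuousSMul ℝ E] {c : ℝ → E} {t : ℝ}
    (hc : SmoothCurveAt c t) : ContinuousAt c t :=
  let ⟨_, hv⟩ := hc.exists_deriv
  hv.continuousAt

lemma map {c : ℝ → E} {t : ℝ} (hc : SmoothCurveAt c t) (L : E →L[ℝ] F) :
    SmoothCurveAt (fun s => L (c s)) t :=
  let ⟨_, hd, h⟩ := hc
  ⟨_, hd.map L, h.fun_comp L⟩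

lemma prodMk {c : ℝ → E} {d : ℝ → F} {t : ℝ} (hc : SmoothCurveAt c t) (hd : SmoothCurveAt d t) :
    SmoothCurveAt (fun s => (c s, d s)) t :=
  let ⟨_, hc', h⟩ := hc
  let ⟨_, hd', h'⟩ := hd
  ⟨_, hc'.prodMk hd', h.prodMk h'⟩

lemma add [IsTopologicalAddGroup E] {c d : ℝ → E} {t : ℝ} (hc : SmoothCurveAt c t)
    (hd : SmoothCurveAt d t) : SmoothCurveAt (fun s => c s + d s) t :=
  let ⟨_, hc', h⟩ := hc
  let ⟨_, hd', h'⟩ := hd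
  ⟨_, hc'.add hd', h.add h'⟩

lemma smul [IsTopologicalAddGroup E] [ContinuousSMul ℝ E] {φ : ℝ → ℝ} {c : ℝ → E} {t : ℝ}
    (hφ : SmoothCurveAt φ t) (hc : SmoothCurveAt c t) : SmoothCurveAt (fun s => φ s • c s) t :=
  let ⟨_, hφ', h⟩ := hφ
  let ⟨_, hc', h'⟩ := hc
  ⟨_, hφ'.smul hc', h.smul h'⟩

end SmoothCurveAt

lemma exists_contDiff_retract {V : Set ℝ} {t : ℝ} (hV : V ∈ 𝓝 t) :
    ∃ φ : ℝ → ℝ, ContDiff ℝ (⊤ : ℕ∞) φ ∧ (∀ s, φ s ∈ V) ∧ ∀ᶠ s in 𝓝 t, φ s = s := by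
  obtain ⟨r, hr, hrV⟩ := Metric.mem_nhds_iff.1 hV
  let b : ContDiffBump t := ⟨r / 2, r, by positivity, by linarith⟩
  refine ⟨fun s => t + b s * (s - t),
    contDiff_const.add (b.contDiff.mul (contDiff_id.sub contDiff_const)), fun s => hrV ?_, ?_⟩
  · rw [Metric.mem_ball, Real.dist_eq, add_sub_cancel_left, abs_mul, abs_of_nonneg b.nonneg]
    rcases lt_or_ge |s - t| r with hs | hs
    · exact (mul_le_of_le_one_left (abs_nonneg _) b.le_one).trans_lt hs
    · rwa [b.zero_of_le_dist hs, zero_mul]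
  · filter_upwards [b.eventuallyEq_one] with s hs
    rw [hs, Pi.one_apply, one_mul, add_sub_cancel]

lemma SmoothCurveAt.exists_smoothCurve [IsTopologicalAddGroup E] [ContinuousSMul ℝ E] {c : ℝ → E}
    {t : ℝ} (hc : SmoothCurveAt c t) {V : Set ℝ} (hV : V ∈ 𝓝 t) :
    ∃ d : ℝ → E, SmoothCurve d ∧ d =ᶠ[𝓝 t] c ∧ ∀ s, d s ∈ c '' V := by
  obtain ⟨d, hd, h⟩ := hc
  obtain ⟨φ, hφ, hφV, hφt⟩ := exists_contDiff_retract (inter_mem hV h)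
  refine ⟨fun s => d (φ s), hd.comp (smoothCurve_of_contDiff hφ), ?_,
    fun s => ⟨φ s, (hφV s).1, (hφV s).2.symm⟩⟩
  filter_upwards [hφt, h] with s hs hs'
  rw [hs, hs']

end SmoothCurveGerms

/-! ### Taylor estimates in locally convex spaces -/

section Taylor

lemma isVonNBounded_range_const {ι E : Type*} [Nonempty ι] [AddCommGroup E] [Module ℝ E]
    [TopologicalSpace E] [ContinuousSMul ℝ E] (v : E) :
    Bornology.IsVonNBounded ℝ (range fun _ : ι => v) := by
  rw [range_const]
  exact Bornology.isVonNBounded_singleton v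

variable {E : Type*} [AddCommGroup E] [Module ℝ E] [TopologicalSpace E]
  [IsTopologicalAddGroup E] [ContinuousSMul ℝ E] [LocallyConvexSpace ℝ E]

lemma isVonNBounded_iff_forall_continuous_seminorm {A : Set E} :
    Bornology.IsVonNBounded ℝ A ↔
      ∀ p : Seminorm ℝ E, Continuous p → ∃ C, ∀ x ∈ A, p x ≤ C := by
  simp only [(PolynormableSpace.withSeminorms ℝ E).isVonNBounded_iff_seminorm_bddAbove,
    bddAbove_def, forall_mem_image, Subtype.forall]

lemma exists_dual_eq_seminorm {p : Seminorm ℝ E} (hp : Continuous p) (z : E) :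
    ∃ l : E →L[ℝ] ℝ, l z = p z ∧ ∀ x, |l x| ≤ p x := by
  rcases eq_or_ne z 0 with rfl | hz
  · exact ⟨0, by rw [map_zero, map_zero], fun x => by
      rw [zero_apply, abs_zero]; exact apply_nonneg p x⟩
  let e := LinearEquiv.toSpanNonzeroSingleton ℝ E z hz
  have he (a : ℝ) : (e a : E) = a • z := rfl
  obtain ⟨l, hl, hlp⟩ := Module.Dual.exists_continuous_extension_of_le_seminorm_real
    (Submodule.span ℝ {z}) (p z • e.symm.toLinearMap) hp fun x => by
      obtain ⟨a, rfl⟩ := e.surjective x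
      simp only [LinearMap.smul_apply, LinearEquiv.coe_coe, LinearEquiv.symm_apply_apply,
        smul_eq_mul, he, map_smul_eq_mul, Real.norm_eq_abs, mul_comm (p z)]
      exact mul_le_mul_of_nonneg_right (le_abs_self a) (apply_nonneg p z)
  exact ⟨l, by simpa [he] using hl (e 1), hlp⟩

lemma seminorm_sub_le_of_hasCurveDeriv {c c' : ℝ → E} {S : Set ℝ} (hS : Convex ℝ S)
    (hc : ∀ t, HasCurveDeriv c (c' t) t) {p : Seminorm ℝ E} (hp : Continuous p) {C : ℝ}
    (hC : ∀ t ∈ S, p (c' t) ≤ C) {a b : ℝ} (ha : a ∈ S) (hb : b ∈ S) :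
    p (c b - c a) ≤ C * |b - a| := by
  obtain ⟨l, hl, hlp⟩ := exists_dual_eq_seminorm hp (c b - c a)
  rw [← hl, map_sub]
  exact (le_abs_self _).trans (hS.norm_image_sub_le_of_norm_hasDerivWithin_le
    (fun t _ => (hasCurveDeriv_iff_hasDerivAt.1 ((hc t).map l)).hasDerivWithinAt)
    (fun t ht => (hlp _).trans (hC t ht)) ha hb)

lemma seminorm_taylor_le {c c' c'' : ℝ → E} {S : Set ℝ} (hS : Convex ℝ S)
    (hc : ∀ t, HasCurveDeriv c (c' t) t) (hc' : ∀ t, HasCurveDeriv c' (c'' t) t)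
    {p : Seminorm ℝ E} (hp : Continuous p) {C : ℝ} (hC : ∀ t ∈ S, p (c'' t) ≤ C) {t h : ℝ}
    (ht : t ∈ S) (hth : t + h ∈ S) : p (c (t + h) - c t - h • c' t) ≤ C * h ^ 2 := by
  have hC0 : 0 ≤ C := (apply_nonneg p _).trans (hC t ht)
  have hderiv (s : ℝ) : HasCurveDeriv (fun s => c s + (t - s) • c' t) (c' s + (-1 : ℝ) • c' t) s :=
    (hc s).add (HasCurveDeriv.smul_const ((hasDerivAt_id s).const_sub t) (c' t))
  have hbound (s : ℝ) (hs : s ∈ uIcc t (t + h)) : p (c' s + (-1 : ℝ) • c' t) ≤ C * |h| := by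
    rw [neg_one_smul, ← sub_eq_add_neg]
    refine (seminorm_sub_le_of_hasCurveDeriv hS hc' hp hC ht
      (hS.ordConnected.uIcc_subset ht hth hs)).trans (mul_le_mul_of_nonneg_left ?_ hC0)
    simpa only [add_sub_cancel_left] using abs_sub_left_of_mem_uIcc hs
  have hmvt := seminorm_sub_le_of_hasCurveDeriv (convex_uIcc t (t + h)) hderiv hp hbound
    left_mem_uIcc right_mem_uIcc
  rw [add_sub_cancel_left, mul_assoc, abs_mul_abs_self, ← sq] at hmvt
  convert hmvt using 2
  rw [sub_self, zero_smul, sub_add_cancel_left, neg_smul]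
  abel

namespace SmoothCurve

lemma exists_seminorm_sub_le {c : ℝ → E} (hc : SmoothCurve c) {p : Seminorm ℝ E}
    (hp : Continuous p) {S : Set ℝ} (hS : Convex ℝ S) (hS' : IsCompact S) :
    ∃ C, ∀ a ∈ S, ∀ b ∈ S, p (c b - c a) ≤ C * |b - a| := by
  obtain ⟨c', hc's, hc'⟩ := hc.exists_deriv
  obtain ⟨C, hC⟩ := hc's.exists_seminorm_le hp hS'
  exact ⟨C, fun a ha b hb => seminorm_sub_le_of_hasCurveDeriv hS hc' hp hC ha hb⟩

lemma exists_seminorm_taylor_le {c c' : ℝ → E} (hc' : SmoothCurve c')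
    (hc : ∀ t, HasCurveDeriv c (c' t) t) {p : Seminorm ℝ E} (hp : Continuous p) {S : Set ℝ}
    (hS : Convex ℝ S) (hS' : IsCompact S) :
    ∃ C, ∀ t h, t ∈ S → t + h ∈ S → p (c (t + h) - c t - h • c' t) ≤ C * h ^ 2 := by
  obtain ⟨c'', hc''s, hc''⟩ := hc'.exists_deriv
  obtain ⟨C, hC⟩ := hc''s.exists_seminorm_le hp hS'
  exact ⟨C, fun t h ht hth => seminorm_taylor_le hS hc hc'' hp hC ht hth⟩

lemma exists_seminorm_second_difference_le {c : ℝ → E} (hc : SmoothCurve c)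
    {p : Seminorm ℝ E} (hp : Continuous p) {S : Set ℝ} (hS : Convex ℝ S) (hS' : IsCompact S) :
    ∃ C, ∀ t h, t + h ∈ S → t - h ∈ S → p (c (t + h) + c (t - h) - (2 : ℝ) • c t) ≤ C * h ^ 2 := by
  obtain ⟨c', hc's, hc'⟩ := hc.exists_deriv
  obtain ⟨C, hC⟩ := hc's.exists_seminorm_taylor_le hc' hp hS hS'
  refine ⟨2 * C, fun t h h₁ h₂ => ?_⟩
  have ht : t ∈ S := by
    convert hS h₁ h₂ (a := 2⁻¹) (b := 2⁻¹) (by norm_num) (by norm_num) (by norm_num) using 1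
    simp only [smul_eq_mul]
    ring
  rw [sub_eq_add_neg] at h₂
  calc p (c (t + h) + c (t - h) - (2 : ℝ) • c t)
      = p ((c (t + h) - c t - h • c' t) + (c (t + -h) - c t - (-h) • c' t)) := by
        congr 1; rw [sub_eq_add_neg t, two_smul, neg_smul]; abel
    _ ≤ C * h ^ 2 + C * (-h) ^ 2 := (map_add_le_add p _ _).trans
        (add_le_add (hC t h ht h₁) (hC t (-h) ht h₂))
    _ = 2 * C * h ^ 2 := by ring

end SmoothCurve

lemma SmoothCurveAt.exists_taylor_remainder [T2Space E] {c : ℝ → E} {v : E} {t : ℝ}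
    (hc : SmoothCurveAt c t) (hv : HasCurveDeriv c v t) :
    ∃ ρ : ℝ → E, Bornology.IsVonNBounded ℝ (range ρ) ∧
      ∀ᶠ h in 𝓝 (0 : ℝ), c (t + h) = c t + h • v + h ^ 2 • ρ h := by
  obtain ⟨d, hd, hdc⟩ := hc
  obtain ⟨d', hd's, hd'⟩ := hd.exists_deriv
  obtain rfl : d' t = v := (hd' t).unique (hv.congr hdc.symm)
  let ρ : ℝ → E := (Icc (-1) 1).indicator fun h => (h ^ 2)⁻¹ • (d (t + h) - d t - h • d' t)
  have hρ {h : ℝ} (hh : h ∈ Icc (-1 : ℝ) 1) : ρ h = (h ^ 2)⁻¹ • (d (t + h) - d t - h • d' t) :=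
    indicator_of_mem hh _
  refine ⟨ρ, isVonNBounded_iff_forall_continuous_seminorm.2 fun p hp => ?_, ?_⟩
  · obtain ⟨C, hC⟩ := hd's.exists_seminorm_taylor_le hd' hp (convex_Icc (t - 1) (t + 1))
      isCompact_Icc
    have hmem : t ∈ Icc (t - 1) (t + 1) := ⟨by linarith, by linarith⟩
    have hC0 : 0 ≤ C := by simpa using (apply_nonneg p _).trans (hC t 1 hmem ⟨by linarith, le_rfl⟩)
    refine ⟨C, forall_mem_range.2 fun h => ?_⟩
    by_cases hh : h ∈ Icc (-1 : ℝ) 1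
    · rw [hρ hh, map_smul_eq_mul, norm_inv, Real.norm_of_nonneg (sq_nonneg h)]
      exact inv_mul_le_of_le_mul₀ (sq_nonneg h) hC0
        ((hC t h hmem ⟨by linarith [hh.1], by linarith [hh.2]⟩).trans_eq (mul_comm _ _))
    · rwa [show ρ h = 0 from indicator_of_notMem hh _, map_zero]
  · filter_upwards [(tendsto_const_add_nhds_zero t).eventually hdc,
      Icc_mem_nhds (neg_one_lt_zero : (-1 : ℝ) < 0) one_pos] with h hh hmem
    rw [← hh, ← hdc.eq_of_nhds]
    rcases eq_or_ne h 0 with rfl | h0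
    · simp
    · rw [hρ hmem, smul_inv_smul₀ (pow_ne_zero 2 h0)]
      abel

end Taylor

/-! ### Bounded bilinear forms -/

section Bilinear

variable {E : Type*} [AddCommGroup E] [Module ℝ E] [TopologicalSpace E]
variable {F : Type*} [AddCommGroup F] [Module ℝ F] [TopologicalSpace F]

/-- A bilinear form that is bounded on products of bounded sets, such as the duality pairing of a
weak subbundle; it need not be continuous. -/
def IsBoundedBilin (B : F →ₗ[ℝ] E →ₗ[ℝ] ℝ) : Prop :=
  ∀ (A : Set F) (A' : Set E), Bornology.IsVonNBounded ℝ A → Bornology.IsVonNBounded ℝ A' →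
    ∃ C : ℝ, ∀ ξ ∈ A, ∀ v ∈ A', |B ξ v| ≤ C

namespace IsBoundedBilin

variable {B : F →ₗ[ℝ] E →ₗ[ℝ] ℝ}

lemma tendsto_mul_zero (hB : IsBoundedBilin B) {ξ : ℝ → F} {v : ℝ → E}
    (hξ : Bornology.IsVonNBounded ℝ (range ξ)) (hv : Bornology.IsVonNBounded ℝ (range v)) :
    Tendsto (fun h => h * B (ξ h) (v h)) (𝓝[≠] 0) (𝓝 0) := by
  obtain ⟨C, hC⟩ := hB _ _ hξ hv
  simp only [mul_comm _ (B _ _)]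
  exact bdd_le_mul_tendsto_zero' C (Eventually.of_forall fun h => hC _ ⟨h, rfl⟩ _ ⟨h, rfl⟩)
    (tendsto_id.mono_left nhdsWithin_le_nhds)

variable [IsTopologicalAddGroup E] [ContinuousSMul ℝ E] [LocallyConvexSpace ℝ E] [T2Space E]
variable [IsTopologicalAddGroup F] [ContinuousSMul ℝ F] [LocallyConvexSpace ℝ F] [T2Space F]

/-- As `B` need not be continuous, convergence of the difference quotients of `ξ` and `w` would not
suffice; their Taylor remainders are bounded, which does. -/
lemma hasCurveDeriv (hB : IsBoundedBilin B) {ξ : ℝ → F} {w : ℝ → E} {ξ' : F} {w' : E} {t : ℝ}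
    (hξs : SmoothCurveAt ξ t) (hws : SmoothCurveAt w t) (hξ : HasCurveDeriv ξ ξ' t)
    (hw : HasCurveDeriv w w' t) :
    HasCurveDeriv (fun s => B (ξ s) (w s)) (B ξ' (w t) + B (ξ t) w') t := by
  obtain ⟨ρ, hρ, hξρ⟩ := hξs.exists_taylor_remainder hξ
  obtain ⟨σ, hσ, hwσ⟩ := hws.exists_taylor_remainder hw
  have hF (η : F) : Bornology.IsVonNBounded ℝ (range fun _ : ℝ => η) := isVonNBounded_range_const η
  have hE (v : E) : Bornology.IsVonNBounded ℝ (range fun _ : ℝ => v) := isVonNBounded_range_const v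
  have hid : Tendsto (fun h : ℝ => h) (𝓝[≠] 0) (𝓝 0) := tendsto_id.mono_left nhdsWithin_le_nhds
  have hlim := (((((hB.tendsto_mul_zero (hF ξ') (hE w')).add
    (hB.tendsto_mul_zero (hF (ξ t)) hσ)).add (hB.tendsto_mul_zero hρ (hE (w t)))).add
    (hid.mul (hB.tendsto_mul_zero (hF ξ') hσ))).add
    (hid.mul (hB.tendsto_mul_zero hρ (hE w')))).add
    (hid.mul (hid.mul (hB.tendsto_mul_zero hρ hσ))) |>.const_add (B ξ' (w t) + B (ξ t) w')
  simp only [mul_zero, add_zero] at hlim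
  refine hlim.congr' ?_
  filter_upwards [nhdsWithin_le_nhds hξρ, nhdsWithin_le_nhds hwσ, self_mem_nhdsWithin]
    with h h₁ h₂ (h0 : h ≠ 0)
  simp only [h₁, h₂, map_add, map_smul, LinearMap.add_apply, LinearMap.smul_apply, smul_eq_mul]
  field_simp
  ring

lemma smoothCurve (hB : IsBoundedBilin B) {ξ : ℝ → F} {w : ℝ → E} (hξ : SmoothCurve ξ)
    (hw : SmoothCurve w) : SmoothCurve (fun t => B (ξ t) (w t)) := by
  let S : Set (ℝ → ℝ) := {b | ∃ (ξ : ℝ → F) (w : ℝ → E),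
    SmoothCurve ξ ∧ SmoothCurve w ∧ b = fun t => B (ξ t) (w t)}
  refine smoothCurve_of_mem_of_deriv_mem_closure (S := S) ?_ ⟨ξ, w, hξ, hw, rfl⟩
  rintro _ ⟨ξ, w, hξ, hw, rfl⟩
  obtain ⟨ξ', hξs, hξ'⟩ := hξ.exists_deriv
  obtain ⟨w', hws, hw'⟩ := hw.exists_deriv
  exact ⟨_, add_mem (AddSubmonoid.subset_closure ⟨ξ', w, hξs, hw, rfl⟩)
    (AddSubmonoid.subset_closure ⟨ξ, w', hξ, hws, rfl⟩), fun t =>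
    hB.hasCurveDeriv (hξ.smoothCurveAt t) (hw.smoothCurveAt t) (hξ' t) (hw' t)⟩

lemma smoothCurveAt (hB : IsBoundedBilin B) {ξ : ℝ → F} {w : ℝ → E} {t : ℝ}
    (hξ : SmoothCurveAt ξ t) (hw : SmoothCurveAt w t) :
    SmoothCurveAt (fun s => B (ξ s) (w s)) t :=
  let ⟨_, hξ', h⟩ := hξ
  let ⟨_, hw', h'⟩ := hw
  ⟨_, hB.smoothCurve hξ' hw', h.comp₂ (fun η v => B η v) h'⟩

end IsBoundedBilin

end Bilinear

/-! ### Smooth maps -/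

section SmoothMaps

variable {E : Type*} [AddCommGroup E] [Module ℝ E] [TopologicalSpace E]
variable {F : Type*} [AddCommGroup F] [Module ℝ F] [TopologicalSpace F]
variable {G : Type*} [AddCommGroup G] [Module ℝ G] [TopologicalSpace G]

/-- The filter of the sets that every smooth curve stays in as long as it is close to `x`.  It is
the neighbourhood filter of convenient calculus: a set is `c^∞`-open when it belongs to the filter
of each of its points. -/
def curveNhds (x : E) : Filter E :=
  ⨆ (c : ℝ → E) (t : ℝ) (_ : SmoothCurveAt c t) (_ : c t = x), map c (𝓝 t)

/-- The map `f` is smooth at `x`: it sends germs of smooth curves at `x` to germs of smooth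
curves. -/
def CSmoothAt (f : E → F) (x : E) : Prop :=
  ∀ (c : ℝ → E) (t : ℝ), SmoothCurveAt c t → c t = x → SmoothCurveAt (fun s => f (c s)) t

lemma mem_curveNhds {x : E} {U : Set E} :
    U ∈ curveNhds x ↔
      ∀ (c : ℝ → E) (t : ℝ), SmoothCurveAt c t → c t = x → ∀ᶠ s in 𝓝 t, c s ∈ U := by
  simp only [curveNhds, mem_iSup, mem_map]
  rfl

lemma tendsto_curveNhds_iff {α : Type*} {f : E → α} {x : E} {l : Filter α} :
    Tendsto f (curveNhds x) l ↔
      ∀ (c : ℝ → E) (t : ℝ), SmoothCurveAt c t → c t = x → Tendsto (fun s => f (c s)) (𝓝 t) l := by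
  simp only [curveNhds, tendsto_iSup, tendsto_map'_iff]
  rfl

lemma SmoothCurveAt.tendsto_curveNhds {c : ℝ → E} {t : ℝ} (hc : SmoothCurveAt c t) {x : E}
    (hx : c t = x) : Tendsto c (𝓝 t) (curveNhds x) :=
  tendsto_curveNhds_iff.1 tendsto_id c t hc hx

lemma eventually_self_of_curveNhds {x : E} {p : E → Prop} (h : ∀ᶠ y in curveNhds x, p y) : p x :=
  (((smoothCurve_const x).smoothCurveAt 0).tendsto_curveNhds rfl |>.eventually h).self_of_nhds

lemma cInftyOpen_iff_mem_curveNhds {U : Set E} :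
    CInftyOpen U ↔ ∀ x ∈ U, U ∈ curveNhds x := by
  refine ⟨fun hU x hx => mem_curveNhds.2 ?_, fun hU c hc => ?_⟩
  · rintro c t ⟨d, hd, hdc⟩ rfl
    filter_upwards [hdc, (hU d hd).mem_nhds (x := t) (by rwa [mem_preimage, hdc.eq_of_nhds])]
      with s hs hsU
    exact hs ▸ hsU
  · exact isOpen_iff_mem_nhds.2 fun t ht => (hc.smoothCurveAt t).tendsto_curveNhds rfl (hU _ ht)

namespace CSmoothAt

lemma tendsto {f : E → F} {x : E} (hf : CSmoothAt f x) :
    Tendsto f (curveNhds x) (curveNhds (f x)) :=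
  tendsto_curveNhds_iff.2 fun c t hc ht => (hf c t hc ht).tendsto_curveNhds (by rw [ht])

lemma congr {f g : E → F} {x : E} (hf : CSmoothAt f x) (h : f =ᶠ[curveNhds x] g) :
    CSmoothAt g x :=
  fun c t hc ht => (hf c t hc ht).congr ((hc.tendsto_curveNhds ht).eventually h)

lemma comp {g : F → G} {f : E → F} {x : E} (hg : CSmoothAt g (f x)) (hf : CSmoothAt f x) :
    CSmoothAt (fun y => g (f y)) x :=
  fun c t hc ht => hg _ t (hf c t hc ht) (by rw [ht])

lemma prodMk {g : E → G} {f : E → F} {x : E} (hg : CSmoothAt g x) (hf : CSmoothAt f x) :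
    CSmoothAt (fun y => (g y, f y)) x :=
  fun c t hc ht => (hg c t hc ht).prodMk (hf c t hc ht)

lemma map {f : E → F} {x : E} (hf : CSmoothAt f x) (L : F →L[ℝ] G) :
    CSmoothAt (fun y => L (f y)) x :=
  fun c t hc ht => (hf c t hc ht).map L

lemma id (x : E) : CSmoothAt (fun y : E => y) x := fun _ _ hc _ => hc

lemma const (v : F) (x : E) : CSmoothAt (fun _ : E => v) x :=
  fun _ t _ _ => (smoothCurve_const v).smoothCurveAt t

lemma add [IsTopologicalAddGroup F] {f g : E → F} {x : E} (hf : CSmoothAt f x)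
    (hg : CSmoothAt g x) : CSmoothAt (fun y => f y + g y) x :=
  fun c t hc ht => (hf c t hc ht).add (hg c t hc ht)

lemma smul [IsTopologicalAddGroup F] [ContinuousSMul ℝ F] {φ : E → ℝ} {f : E → F} {x : E}
    (hφ : CSmoothAt φ x) (hf : CSmoothAt f x) : CSmoothAt (fun y => φ y • f y) x :=
  fun c t hc ht => (hφ c t hc ht).smul (hf c t hc ht)

lemma sum [IsTopologicalAddGroup F] {ι : Type*} (s : Finset ι) {f : ι → E → F} {x : E}
    (hf : ∀ i ∈ s, CSmoothAt (f i) x) : CSmoothAt (fun y => ∑ i ∈ s, f i y) x := by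
  classical
  induction s using Finset.induction_on with
  | empty => simpa only [Finset.sum_empty] using const 0 x
  | insert i s hi ih =>
    rw [Finset.forall_mem_insert] at hf
    simpa only [Finset.sum_insert hi] using hf.1.add (ih hf.2)

end CSmoothAt

lemma cSmoothOn_of_forall_cSmoothAt [T2Space F] {U : Set E} {f : E → F}
    (hf : ∀ x ∈ U, CSmoothAt f x) : CSmoothOn U f := fun c hc hcU =>
  smoothCurve_of_forall_smoothCurveAt fun t => hf _ (hcU t) c t (hc.smoothCurveAt t) rfl

lemma curveNhds_le_nhds [IsTopologicalAddGroup E] [ContinuousSMul ℝ E] (x : E) :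
    curveNhds x ≤ 𝓝 x :=
  tendsto_curveNhds_iff (f := id).2 fun _ _ hc ht => ht ▸ hc.continuousAt

lemma CSmoothOn.cSmoothAt [IsTopologicalAddGroup E] [ContinuousSMul ℝ E] {U : Set E}
    {f : E → F} (hf : CSmoothOn U f) {x : E} (hU : U ∈ curveNhds x) : CSmoothAt f x := by
  intro c t hc ht
  obtain ⟨d, hd, hdc, hdU⟩ := hc.exists_smoothCurve (hc.tendsto_curveNhds ht hU)
  refine ((hf d hd fun s => ?_).smoothCurveAt t).congr (hdc.fun_comp f)
  obtain ⟨r, hr, h⟩ := hdU s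
  exact h ▸ hr

end SmoothMaps

/-! ### Directional derivatives -/

section DirectionalDerivative

variable {E : Type*} [AddCommGroup E] [Module ℝ E]
variable {F : Type*} [AddCommGroup F] [Module ℝ F] [TopologicalSpace F]

lemma HasCurveDeriv.cdiff_eq [T2Space F] {f : E → F} {x v : E} {w : F}
    (h : HasCurveDeriv (fun t : ℝ => f (x + t • v)) w 0) : cdiff f x v = w := by
  refine Tendsto.limUnder_eq ?_
  simpa only [HasCurveDeriv, zero_add, zero_smul, add_zero] using h

variable [TopologicalSpace E] [IsTopologicalAddGroup E] [ContinuousSMul ℝ E]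

lemma cdiff_congr {f g : E → F} {x : E} (h : f =ᶠ[curveNhds x] g) (v : E) :
    cdiff f x v = cdiff g x v := by
  have hline : ∀ᶠ t in 𝓝[≠] (0 : ℝ), f (x + t • v) = g (x + t • v) :=
    nhdsWithin_le_nhds <| ((smoothCurve_line x v).smoothCurveAt 0).tendsto_curveNhds
      (by rw [zero_smul, add_zero]) |>.eventually h
  refine congrArg lim (map_congr ?_)
  filter_upwards [hline] with t ht
  rw [ht, eventually_self_of_curveNhds h]

namespace CSmoothAt

lemma smoothCurveAt_line {f : E → F} {x : E} (hf : CSmoothAt f x) (v : E) :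
    SmoothCurveAt (fun t : ℝ => f (x + t • v)) 0 :=
  hf _ 0 ((smoothCurve_line x v).smoothCurveAt 0) (by rw [zero_smul, add_zero])

lemma hasCurveDeriv_line [T2Space F] {f : E → F} {x : E} (hf : CSmoothAt f x) (v : E) :
    HasCurveDeriv (fun t : ℝ => f (x + t • v)) (cdiff f x v) 0 := by
  obtain ⟨w, hw⟩ := (hf.smoothCurveAt_line v).exists_deriv
  rwa [hw.cdiff_eq]

lemma cdiff_add [T2Space F] [IsTopologicalAddGroup F] {f g : E → F} {x : E}
    (hf : CSmoothAt f x) (hg : CSmoothAt g x) (v : E) :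
    cdiff (fun y => f y + g y) x v = cdiff f x v + cdiff g x v :=
  HasCurveDeriv.cdiff_eq (f := fun y => f y + g y)
    ((hf.hasCurveDeriv_line v).add (hg.hasCurveDeriv_line v))

lemma map_cdiff [T2Space F] {G : Type*} [AddCommGroup G] [Module ℝ G] [TopologicalSpace G]
    [T2Space G] {f : E → F} {x : E} (hf : CSmoothAt f x) (L : F →L[ℝ] G) (v : E) :
    L (cdiff f x v) = cdiff (fun y => L (f y)) x v :=
  (HasCurveDeriv.cdiff_eq (f := fun y => L (f y)) ((hf.hasCurveDeriv_line v).map L)).symm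

lemma cdiff_apply_smul [T2Space F] [ContinuousSMul ℝ F] {f : E → F} {x : E} (hf : CSmoothAt f x)
    (a : ℝ) (v : E) : cdiff f x (a • v) = a • cdiff f x v := by
  refine HasCurveDeriv.cdiff_eq ?_
  have hline : HasCurveDeriv (fun t : ℝ => f (x + t • v)) (cdiff f x v) (0 * a) := by
    rw [zero_mul]
    exact hf.hasCurveDeriv_line v
  simpa only [mul_smul] using HasCurveDeriv.comp (c := fun t : ℝ => f (x + t • v))
    (φ := fun t => t * a) hline (hasDerivAt_mul_const a)

end CSmoothAt

end DirectionalDerivative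

/-! ### Curves through rapidly converging sequences -/

section SpecialCurve

/-- Sequences that decay faster than all the powers of `2 ^ (-n)`, the requirement on the
coefficients of a smooth curve that visits the times `2 ^ (-n)`. -/
def RapidlyDecaying (α : ℕ → ℝ) : Prop := ∀ k : ℕ, ∃ C, ∀ n, |α n| * (2 ^ n) ^ k ≤ C

namespace RapidlyDecaying

lemma mul_two_pow {α : ℕ → ℝ} (hα : RapidlyDecaying α) : RapidlyDecaying fun n => α n * 2 ^ n :=
  fun k => (hα (k + 1)).imp fun C hC n => by
    rw [abs_mul, abs_of_pos (by positivity : (0 : ℝ) < 2 ^ n), mul_assoc, ← pow_succ']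
    exact hC n

lemma mono {α β : ℕ → ℝ} (hα : RapidlyDecaying α) (h : ∀ n, |β n| ≤ |α n|) :
    RapidlyDecaying β :=
  fun k => (hα k).imp fun _ hC n => (mul_le_mul_of_nonneg_right (h n) (by positivity)).trans (hC n)

end RapidlyDecaying

/-- The sequence `2 ^ (-n²)`, a standard rapidly decaying one. -/
noncomputable def rapidSeq (n : ℕ) : ℝ := (1 / 2) ^ (n ^ 2)

lemma rapidSeq_pos (n : ℕ) : 0 < rapidSeq n := by unfold rapidSeq; positivity

lemma rapidSeq_le_one (n : ℕ) : rapidSeq n ≤ 1 := pow_le_one₀ (by norm_num) (by norm_num)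

lemma rapidlyDecaying_rapidSeq : RapidlyDecaying rapidSeq := fun k => by
  refine ⟨2 ^ (k ^ 2), fun n => ?_⟩
  rw [abs_of_pos (rapidSeq_pos n), rapidSeq, one_div, inv_pow, inv_mul_le_iff₀ (by positivity),
    ← pow_mul, ← pow_add]
  exact pow_le_pow_right₀ one_le_two (by nlinarith [two_mul_le_add_sq n k, Nat.zero_le (n * k)])

lemma tendsto_rapidSeq : Tendsto rapidSeq atTop (𝓝 0) :=
  (tendsto_pow_atTop_nhds_zero_of_lt_one (by norm_num) (by norm_num)).comp
    (tendsto_pow_atTop two_ne_zero)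

lemma two_pow_window_unique {n m : ℕ} {τ : ℝ} (hn : |2 ^ n * τ - 1| < 1 / 4)
    (hm : |2 ^ m * τ - 1| < 1 / 4) : n = m := by
  wlog h : n < m generalizing n m
  · exact (not_lt.1 h).lt_or_eq.elim (fun h => (this hm hn h).symm) Eq.symm
  obtain ⟨k, rfl⟩ := Nat.exists_eq_add_of_lt h
  rw [show (2 : ℝ) ^ (n + k + 1) * τ = 2 ^ k * (2 * (2 ^ n * τ)) by ring] at hm
  rw [abs_lt] at hn hm
  nlinarith [one_le_pow₀ (one_le_two (α := ℝ)) (n := k)]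

lemma eventually_lt_abs_two_pow_mul_sub_one {τ : ℝ} (hτ : τ ≠ 0) :
    ∃ n : ℕ, ∀ᶠ s in 𝓝 τ, ∀ m ≠ n, 1 / 5 < |2 ^ m * s - 1| := by
  obtain ⟨n, hn⟩ : ∃ n : ℕ, ∀ m ≠ n, 1 / 4 ≤ |2 ^ m * τ - 1| := by
    by_cases h : ∃ n : ℕ, |2 ^ n * τ - 1| < 1 / 4
    · obtain ⟨n, hn⟩ := h
      exact ⟨n, fun m hm => not_lt.1 fun hm' => hm (two_pow_window_unique hm' hn)⟩
    · exact ⟨0, fun m _ => not_lt.1 fun hm => h ⟨m, hm⟩⟩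
  refine ⟨n, ?_⟩
  filter_upwards [Metric.ball_mem_nhds τ (by positivity : 0 < |τ| / 100)] with s hs m hm
  rw [Metric.mem_ball, Real.dist_eq, abs_sub_comm] at hs
  have hscale : |2 ^ m * τ - 2 ^ m * s| ≤ |2 ^ m * τ| / 100 := by
    rw [← mul_sub, abs_mul, abs_mul, mul_div_assoc]
    gcongr
  have hτ1 := abs_sub_abs_le_abs_sub (2 ^ m * τ) 1
  have hτs := abs_sub_le (2 ^ m * τ) (2 ^ m * s) 1
  rw [abs_one] at hτ1
  linarith [hn m hm]

section WindowCurve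

variable {E : Type*} [AddCommGroup E] [Module ℝ E]

/-- The curve that equals `α n • θ (2 ^ n * τ - 1) • v n` near the time `τ = 2 ^ (-n)`.  It is used
with profiles `θ` supported in `[-1 / 5, 1 / 5]`, for which the windows
`|2 ^ n * τ - 1| ≤ 1 / 5` are disjoint. -/
noncomputable def windowCurve (θ : ℝ → ℝ) (α : ℕ → ℝ) (v : ℕ → E) (τ : ℝ) : E :=
  ∑ᶠ n, (α n * θ (2 ^ n * τ - 1)) • v n

variable {θ : ℝ → ℝ}

lemma eq_zero_of_tsupport_subset_closedBall {r s : ℝ} (hsupp : tsupport θ ⊆ Metric.closedBall 0 r)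
    (hs : r < |s|) : θ s = 0 :=
  image_eq_zero_of_notMem_tsupport fun h => (mem_closedBall_zero_iff.1 (hsupp h)).not_gt hs

lemma windowCurve_eq (hsupp : tsupport θ ⊆ Metric.closedBall 0 (1 / 5)) (α : ℕ → ℝ) (v : ℕ → E)
    {τ : ℝ} {n : ℕ} (h : ∀ m ≠ n, 1 / 5 < |2 ^ m * τ - 1|) :
    windowCurve θ α v τ = (α n * θ (2 ^ n * τ - 1)) • v n :=
  finsum_eq_single _ n fun m hm => by
    rw [eq_zero_of_tsupport_subset_closedBall hsupp (h m hm), mul_zero, zero_smul]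

lemma windowCurve_zero (hsupp : tsupport θ ⊆ Metric.closedBall 0 (1 / 5)) (α : ℕ → ℝ) (v : ℕ → E) :
    windowCurve θ α v 0 = 0 := by
  have hθ : θ (-1) = 0 := eq_zero_of_tsupport_subset_closedBall hsupp (by norm_num)
  simp only [windowCurve, mul_zero, zero_sub, hθ, zero_smul, finsum_zero]

lemma windowCurve_half_pow (hsupp : tsupport θ ⊆ Metric.closedBall 0 (1 / 5))
    (α : ℕ → ℝ) (v : ℕ → E) (n : ℕ) {s : ℝ} (hs : |s| ≤ 1 / 8) :
    windowCurve θ α v ((1 / 2) ^ n + s * (1 / 2) ^ n) = (α n * θ s) • v n := by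
  have hn : (2 : ℝ) ^ n * ((1 / 2) ^ n + s * (1 / 2) ^ n) - 1 = s := by
    have : (2 : ℝ) ^ n * (1 / 2) ^ n = 1 := by rw [← mul_pow]; norm_num
    linear_combination (1 + s) * this
  have hn' : |(2 : ℝ) ^ n * ((1 / 2) ^ n + s * (1 / 2) ^ n) - 1| < 1 / 4 := by
    rw [hn]; linarith
  rw [windowCurve, finsum_eq_single _ n fun m hm => ?_, hn]
  rw [eq_zero_of_tsupport_subset_closedBall hsupp, mul_zero, zero_smul]
  have := not_lt.1 fun hm' => hm (two_pow_window_unique hm' hn')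
  linarith

lemma exists_windowCurve_eq_sq_smul (hsupp : tsupport θ ⊆ Metric.closedBall 0 (1 / 5))
    (hθ : Continuous θ) {α : ℕ → ℝ} (hα : RapidlyDecaying α) (v : ℕ → E) :
    ∃ K : ℝ, ∀ τ, ∃ (a : ℝ) (n : ℕ), |a| ≤ K ∧ windowCurve θ α v τ = τ ^ 2 • a • v n := by
  obtain ⟨C, hC⟩ := hα 2
  obtain ⟨R, hR⟩ := hθ.bounded_above_of_compact_support
    ((isCompact_closedBall (0 : ℝ) (1 / 5)).of_isClosed_subset (isClosed_tsupport θ) hsupp)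
  have hR0 : 0 ≤ R := (norm_nonneg _).trans (hR 0)
  have hC0 : 0 ≤ C := le_trans (by positivity) (hC 0)
  have hCR : 0 ≤ 4 * C * R := by positivity
  refine ⟨4 * C * R, fun τ => ?_⟩
  rcases eq_or_ne τ 0 with rfl | hτ
  · exact ⟨0, 0, by rwa [abs_zero], by rw [windowCurve_zero hsupp α v, zero_smul, smul_zero]⟩
  obtain ⟨n, hn⟩ := eventually_lt_abs_two_pow_mul_sub_one hτ
  refine ⟨(τ ^ 2)⁻¹ * (α n * θ (2 ^ n * τ - 1)), n, ?_, by
    rw [windowCurve_eq hsupp α v hn.self_of_nhds, smul_smul,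
      mul_inv_cancel_left₀ (pow_ne_zero 2 hτ)]⟩
  rcases lt_or_ge (1 / 5) |2 ^ n * τ - 1| with hout | hin
  · rwa [eq_zero_of_tsupport_subset_closedBall hsupp hout, mul_zero, mul_zero, abs_zero]
  have hτn : 1 ≤ 4 * τ ^ 2 * (2 ^ n) ^ 2 := by nlinarith [(abs_le.1 hin).1]
  rw [abs_mul, abs_mul, abs_inv, abs_of_pos (by positivity : 0 < τ ^ 2),
    inv_mul_le_iff₀ (by positivity)]
  calc |α n| * |θ (2 ^ n * τ - 1)| ≤ |α n| * (4 * τ ^ 2 * (2 ^ n) ^ 2) * R := by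
        gcongr
        · exact le_mul_of_one_le_right (abs_nonneg _) hτn
        · exact hR _
    _ = τ ^ 2 * (4 * (|α n| * (2 ^ n) ^ 2) * R) := by ring
    _ ≤ τ ^ 2 * (4 * C * R) := by gcongr; exact hC n

variable [TopologicalSpace E] [IsTopologicalAddGroup E] [ContinuousSMul ℝ E]
  [LocallyConvexSpace ℝ E] {v : ℕ → E}

lemma hasCurveDeriv_windowCurve_zero (hsupp : tsupport θ ⊆ Metric.closedBall 0 (1 / 5))
    (hθ : Continuous θ) {α : ℕ → ℝ} (hα : RapidlyDecaying α)
    (hv : Bornology.IsVonNBounded ℝ (range v)) : HasCurveDeriv (windowCurve θ α v) 0 0 := by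
  obtain ⟨K, hK⟩ := exists_windowCurve_eq_sq_smul hsupp hθ hα v
  choose a n ha h using hK
  have hbdd : Bornology.IsVonNBounded ℝ (range fun τ => a τ • v (n τ)) := by
    refine isVonNBounded_iff_forall_continuous_seminorm.2 fun p hp => ?_
    obtain ⟨R, hR⟩ := isVonNBounded_iff_forall_continuous_seminorm.1 hv p hp
    refine ⟨K * R, forall_mem_range.2 fun τ => ?_⟩
    rw [map_smul_eq_mul]
    exact mul_le_mul (ha τ) (hR _ (mem_range_self _)) (apply_nonneg p _)
      ((abs_nonneg _).trans (ha τ))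
  have hlim : Tendsto (fun τ : ℝ => τ • a τ • v (n τ)) (𝓝[≠] 0) (𝓝 0) :=
    hbdd.smul_tendsto_zero (Eventually.of_forall fun τ => mem_range_self τ)
      (tendsto_id.mono_left nhdsWithin_le_nhds)
  refine hlim.congr' ?_
  filter_upwards [self_mem_nhdsWithin] with τ hτ
  rw [zero_add, windowCurve_zero hsupp α v, sub_zero, h, pow_two, mul_smul, inv_smul_smul₀ hτ]

lemma hasCurveDeriv_windowCurve (hsupp : tsupport θ ⊆ Metric.closedBall 0 (1 / 5))
    (hθ : Differentiable ℝ θ) {α : ℕ → ℝ} (hα : RapidlyDecaying α)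
    (hv : Bornology.IsVonNBounded ℝ (range v)) (τ : ℝ) :
    HasCurveDeriv (windowCurve θ α v) (windowCurve (deriv θ) (fun n => α n * 2 ^ n) v τ) τ := by
  have hsupp' : tsupport (deriv θ) ⊆ Metric.closedBall 0 (1 / 5) :=
    tsupport_deriv_subset.trans hsupp
  rcases eq_or_ne τ 0 with rfl | hτ
  · rw [windowCurve_zero hsupp' _ v]
    exact hasCurveDeriv_windowCurve_zero hsupp hθ.continuous hα hv
  obtain ⟨n, hn⟩ := eventually_lt_abs_two_pow_mul_sub_one hτ
  have hinner : HasDerivAt (fun s : ℝ => 2 ^ n * s - 1) (2 ^ n) τ := by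
    simpa only [mul_one, id_def] using ((hasDerivAt_id τ).const_mul ((2 : ℝ) ^ n)).sub_const 1
  have hcoeff : HasDerivAt (fun s => α n * θ (2 ^ n * s - 1))
      (α n * 2 ^ n * deriv θ (2 ^ n * τ - 1)) τ :=
    (((hθ _).hasDerivAt.comp τ hinner).const_mul (α n)).congr_deriv (by ring)
  rw [windowCurve_eq hsupp' _ _ hn.self_of_nhds]
  refine (HasCurveDeriv.smul_const hcoeff (v n)).congr ?_
  filter_upwards [hn] with s hs
  rw [windowCurve_eq hsupp _ _ hs]

lemma smoothCurve_windowCurve (hsupp : tsupport θ ⊆ Metric.closedBall 0 (1 / 5))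
    (hθ : ContDiff ℝ (⊤ : ℕ∞) θ) {α : ℕ → ℝ} (hα : RapidlyDecaying α)
    (hv : Bornology.IsVonNBounded ℝ (range v)) : SmoothCurve (windowCurve θ α v) := by
  refine smoothCurve_of_mem (S := {c | ∃ (θ : ℝ → ℝ) (α : ℕ → ℝ),
    tsupport θ ⊆ Metric.closedBall 0 (1 / 5) ∧ ContDiff ℝ (⊤ : ℕ∞) θ ∧ RapidlyDecaying α ∧
      c = windowCurve θ α v}) ?_ ⟨θ, α, hsupp, hθ, hα, rfl⟩
  rintro _ ⟨θ, α, hsupp, hθ, hα, rfl⟩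
  have hθ' := contDiff_infty_iff_deriv.1 hθ
  exact ⟨_, ⟨_, _, tsupport_deriv_subset.trans hsupp, hθ'.2, hα.mul_two_pow, rfl⟩,
    hasCurveDeriv_windowCurve hsupp hθ'.1 hα hv⟩

end WindowCurve

variable {E : Type*} [AddCommGroup E] [Module ℝ E] [TopologicalSpace E]
  [IsTopologicalAddGroup E] [ContinuousSMul ℝ E] [LocallyConvexSpace ℝ E]

/-- With `ρ = rapidSeq n`, the curve makes the displacement `ρ ^ 3 • w n` in the time
`ρ ^ 2 * 2 ^ (-n)`.  Second differences for this displacement are therefore `O(ρ ^ 4)`, which is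
negligible against `ρ ^ 3`. -/
lemma exists_smoothCurve_through_segments (x : E) {v w : ℕ → E}
    (hv : Bornology.IsVonNBounded ℝ (range v)) (hw : Bornology.IsVonNBounded ℝ (range w)) :
    ∃ γ : ℝ → E, SmoothCurve γ ∧ γ 0 = x ∧ ∀ (n : ℕ) (s : ℝ), |s| ≤ 1 / 8 →
      γ ((1 / 2) ^ n + s * (1 / 2) ^ n) = x + rapidSeq n ^ 3 • v n + (rapidSeq n * s) • w n := by
  let b : ContDiffBump (0 : ℝ) := ⟨1 / 8, 1 / 5, by norm_num, by norm_num⟩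
  have hb : tsupport b ⊆ Metric.closedBall 0 (1 / 5) := b.tsupport_eq.subset
  have hb' : tsupport (fun s => s * b s) ⊆ Metric.closedBall 0 (1 / 5) :=
    tsupport_mul_subset_right.trans hb
  have hρ3 : RapidlyDecaying fun n => rapidSeq n ^ 3 := rapidlyDecaying_rapidSeq.mono fun n => by
    rw [abs_of_pos (pow_pos (rapidSeq_pos n) 3), abs_of_pos (rapidSeq_pos n)]
    exact pow_le_of_le_one (rapidSeq_pos n).le (rapidSeq_le_one n) three_ne_zero
  refine ⟨fun τ => x + windowCurve b (fun n => rapidSeq n ^ 3) v τ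
      + windowCurve (fun s => s * b s) rapidSeq w τ, ?_, ?_, fun n s hs => ?_⟩
  · exact ((smoothCurve_const x).add (smoothCurve_windowCurve hb b.contDiff hρ3 hv)).add
      (smoothCurve_windowCurve hb' (contDiff_id.mul b.contDiff) rapidlyDecaying_rapidSeq hw)
  · simp only [windowCurve_zero hb, windowCurve_zero hb', add_zero]
  · simp only [windowCurve_half_pow hb _ _ n hs, windowCurve_half_pow hb' _ _ n hs,
      b.one_of_mem_closedBall (mem_closedBall_zero_iff.2 hs), mul_one]

end SpecialCurve

/-! ### Linearity of the differential and the chain rule -/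

section ChainRule

open Asymptotics

lemma rapidSeq_pow_isLittleO {k l : ℕ} (h : k < l) :
    (fun n => rapidSeq n ^ l) =o[atTop] fun n => rapidSeq n ^ k :=
  (isLittleO_pow_pow h).comp_tendsto tendsto_rapidSeq

lemma tendsto_rapidSeq_pow {k : ℕ} (hk : k ≠ 0) :
    Tendsto (fun n => rapidSeq n ^ k) atTop (𝓝 0) := by
  simpa only [zero_pow hk] using tendsto_rapidSeq.pow k

lemma HasCurveDeriv.tendsto_rapidSeq {E : Type*} [AddCommGroup E] [Module ℝ E]
    [TopologicalSpace E] {c : ℝ → E} {v : E} {t : ℝ} (hc : HasCurveDeriv c v t) :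
    Tendsto (fun n => (rapidSeq n ^ 3)⁻¹ • (c (t + rapidSeq n ^ 3) - c t)) atTop (𝓝 v) :=
  Tendsto.comp (f := fun n => rapidSeq n ^ 3) hc <| tendsto_nhdsWithin_iff.2
    ⟨tendsto_rapidSeq_pow three_ne_zero,
      Eventually.of_forall fun n => (pow_pos (rapidSeq_pos n) 3).ne'⟩

lemma isBigO_mul_half_pow (s : ℕ → ℝ) : (fun n => s n * (1 / 2) ^ n) =O[atTop] s :=
  .of_bound 1 <| .of_forall fun n => by
    rw [norm_mul, mul_comm]
    gcongr
    rw [norm_pow]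
    exact pow_le_one₀ (norm_nonneg _) (by norm_num)

lemma eventually_abs_le_eighth : ∀ᶠ s in 𝓝 (0 : ℝ), |s| ≤ 1 / 8 :=
  continuous_abs.continuousAt.eventually_le_const (by norm_num)

lemma half_pow_add_mem (n : ℕ) {s : ℝ} (hs : |s| ≤ 1 / 8) :
    (1 / 2) ^ n + s * (1 / 2) ^ n ∈ Metric.closedBall (0 : ℝ) 2 := by
  have h0 : (0 : ℝ) < (1 / 2) ^ n := by positivity
  have h1 : (1 / 2 : ℝ) ^ n ≤ 1 := pow_le_one₀ (by norm_num) (by norm_num)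
  rw [abs_le] at hs
  rw [mem_closedBall_zero_iff, Real.norm_eq_abs, abs_le]
  constructor <;> nlinarith

lemma curveNhds_eq_nhds {E : Type*} [NormedAddCommGroup E] [NormedSpace ℝ E] (x : E) :
    curveNhds x = 𝓝 x := by
  refine le_antisymm (curveNhds_le_nhds x) fun U hU => ?_
  by_contra hUx
  have hex : ∀ n, ∃ z, ‖z - x‖ < rapidSeq n ^ 3 ∧ z ∉ U := fun n => by
    by_contra! h
    exact hUx (Metric.mem_nhds_iff.2
      ⟨_, pow_pos (rapidSeq_pos n) 3, fun z hz => h z (mem_ball_iff_norm.1 hz)⟩)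
  choose z hz hzU using hex
  have hv : Bornology.IsVonNBounded ℝ (range fun n => (rapidSeq n ^ 3)⁻¹ • (z n - x)) := by
    refine (NormedSpace.isVonNBounded_closedBall ℝ E 1).subset (range_subset_iff.2 fun n => ?_)
    have hρ := pow_pos (rapidSeq_pos n) 3
    rw [mem_closedBall_zero_iff, norm_smul, norm_inv, Real.norm_of_nonneg hρ.le,
      inv_mul_le_one₀ hρ]
    exact (hz n).le
  obtain ⟨γ, hγ, hγx, hγz⟩ := exists_smoothCurve_through_segments x hv
    (isVonNBounded_range_const (0 : E))
  have hγU := (tendsto_pow_atTop_nhds_zero_of_lt_one (r := (1 / 2 : ℝ)) (by norm_num)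
    (by norm_num)).eventually ((hγ.smoothCurveAt 0).tendsto_curveNhds hγx hU)
  obtain ⟨n, hn⟩ := hγU.exists
  refine hzU n ?_
  have := hγz n 0 (by norm_num)
  rw [zero_mul, add_zero, smul_zero, add_zero, smul_inv_smul₀ (pow_pos (rapidSeq_pos n) 3).ne',
    add_sub_cancel] at this
  rwa [← this]

variable {E : Type*} [AddCommGroup E] [Module ℝ E] [TopologicalSpace E]
  [IsTopologicalAddGroup E] [ContinuousSMul ℝ E] [LocallyConvexSpace ℝ E]

namespace CSmoothAt

lemma exists_smoothCurve_eq_on_segments {g : E → ℝ} {x : E} (hg : CSmoothAt g x) {v w : ℕ → E}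
    (hv : Bornology.IsVonNBounded ℝ (range v)) (hw : Bornology.IsVonNBounded ℝ (range w)) :
    ∃ d : ℝ → ℝ, SmoothCurve d ∧ ∀ᶠ n in atTop, ∀ s : ℝ, |s| ≤ 1 / 8 →
      g (x + rapidSeq n ^ 3 • v n + (rapidSeq n * s) • w n) =
        d ((1 / 2) ^ n + s * (1 / 2) ^ n) := by
  obtain ⟨γ, hγ, hγ0, hγs⟩ := exists_smoothCurve_through_segments x hv hw
  obtain ⟨d, hd, hdγ⟩ := hg γ 0 (hγ.smoothCurveAt 0) hγ0
  obtain ⟨r, hr, hdr⟩ := Metric.eventually_nhds_iff.1 hdγ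
  refine ⟨d, hd, ?_⟩
  filter_upwards [(tendsto_pow_atTop_nhds_zero_of_lt_one (r := (1 / 2 : ℝ)) (by norm_num)
    (by norm_num)).eventually_lt_const (half_pos hr)] with n hn s hs
  rw [← hγs n s hs, hdr]
  have hpos : (0 : ℝ) < (1 / 2) ^ n := by positivity
  rw [dist_zero_right, Real.norm_eq_abs, abs_lt]
  constructor <;> nlinarith [abs_le.1 hs]

lemma isBigO_sub_on_segments {g : E → ℝ} {x : E} (hg : CSmoothAt g x) {v w : ℕ → E}
    (hv : Bornology.IsVonNBounded ℝ (range v)) (hw : Bornology.IsVonNBounded ℝ (range w))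
    {s : ℕ → ℝ} (hs : Tendsto s atTop (𝓝 0)) :
    (fun n => g (x + rapidSeq n ^ 3 • v n + (rapidSeq n * s n) • w n)
      - g (x + rapidSeq n ^ 3 • v n)) =O[atTop] s := by
  obtain ⟨d, hd, hgd⟩ := hg.exists_smoothCurve_eq_on_segments hv hw
  obtain ⟨C, hC⟩ := hd.exists_seminorm_sub_le (p := normSeminorm ℝ ℝ) continuous_norm
    (convex_closedBall 0 2) (isCompact_closedBall 0 2)
  refine (IsBigO.of_bound C ?_).trans (isBigO_mul_half_pow s)
  filter_upwards [hgd, hs.eventually eventually_abs_le_eighth] with n hn hsn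
  have hg0 := hn 0 (by norm_num)
  rw [mul_zero, zero_smul, add_zero, zero_mul, add_zero] at hg0
  have hmem0 := half_pow_add_mem n (s := 0) (by norm_num)
  rw [zero_mul, add_zero] at hmem0
  rw [hn _ hsn, hg0]
  have h := hC _ hmem0 _ (half_pow_add_mem n hsn)
  rw [add_sub_cancel_left] at h
  exact h

lemma isBigO_second_difference_on_segments {g : E → ℝ} {x : E} (hg : CSmoothAt g x)
    {v w : ℕ → E} (hv : Bornology.IsVonNBounded ℝ (range v))
    (hw : Bornology.IsVonNBounded ℝ (range w)) {s : ℕ → ℝ} (hs : Tendsto s atTop (𝓝 0)) :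
    (fun n => g (x + rapidSeq n ^ 3 • v n + (rapidSeq n * s n) • w n)
      + g (x + rapidSeq n ^ 3 • v n + (rapidSeq n * -s n) • w n)
      - 2 * g (x + rapidSeq n ^ 3 • v n)) =O[atTop] fun n => s n ^ 2 := by
  obtain ⟨d, hd, hgd⟩ := hg.exists_smoothCurve_eq_on_segments hv hw
  obtain ⟨C, hC⟩ := hd.exists_seminorm_second_difference_le (p := normSeminorm ℝ ℝ)
    continuous_norm (convex_closedBall 0 2) (isCompact_closedBall 0 2)
  refine (IsBigO.of_bound C ?_).trans ((isBigO_mul_half_pow s).pow 2)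
  filter_upwards [hgd, hs.eventually eventually_abs_le_eighth] with n hn hsn
  have hg0 := hn 0 (by norm_num)
  rw [mul_zero, zero_smul, add_zero, zero_mul, add_zero] at hg0
  have hsn' : |-s n| ≤ 1 / 8 := by rwa [abs_neg]
  have h := hC ((1 / 2) ^ n) (s n * (1 / 2) ^ n) (half_pow_add_mem n hsn)
    (by simpa only [neg_mul, ← sub_eq_add_neg] using half_pow_add_mem n hsn')
  rw [hn _ hsn, hn _ hsn', hg0, neg_mul, ← sub_eq_add_neg, norm_pow, Real.norm_eq_abs,
    Real.norm_eq_abs, sq_abs]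
  exact h

lemma cdiff_midpoint_real {g : E → ℝ} {x : E} (hg : CSmoothAt g x) (m w : E) :
    cdiff g x (m + w) + cdiff g x (m - w) = 2 * cdiff g x m := by
  have hsmall : (fun n => g (x + rapidSeq n ^ 3 • (m + w)) + g (x + rapidSeq n ^ 3 • (m - w))
      - 2 * g (x + rapidSeq n ^ 3 • m)) =o[atTop] fun n => rapidSeq n ^ 3 := by
    refine ((hg.isBigO_second_difference_on_segments (isVonNBounded_range_const m)
      (isVonNBounded_range_const w) (tendsto_rapidSeq_pow two_ne_zero)).congr (fun n => ?_)
        fun n => (pow_mul _ 2 2).symm).trans_isLittleO (rapidSeq_pow_isLittleO (by norm_num))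
    have e₁ : x + rapidSeq n ^ 3 • m + (rapidSeq n * rapidSeq n ^ 2) • w =
        x + rapidSeq n ^ 3 • (m + w) := by module
    have e₂ : x + rapidSeq n ^ 3 • m + (rapidSeq n * -rapidSeq n ^ 2) • w =
        x + rapidSeq n ^ 3 • (m - w) := by module
    rw [e₁, e₂]
  have h₁ := (hg.hasCurveDeriv_line (m + w)).tendsto_rapidSeq
  have h₂ := (hg.hasCurveDeriv_line (m - w)).tendsto_rapidSeq
  have h₀ := (hg.hasCurveDeriv_line m).tendsto_rapidSeq
  have hlim := (h₁.add h₂).sub (h₀.const_mul 2)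
  simp only [zero_add, zero_smul, add_zero] at hlim
  refine sub_eq_zero.1 (tendsto_nhds_unique hlim (hsmall.tendsto_inv_smul_nhds_zero.congr
    fun n => ?_))
  simp only [smul_eq_mul]
  ring

lemma eq_cdiff_of_hasCurveDeriv_real [T2Space E] {g : E → ℝ} {c : ℝ → E} {v : E} {t a : ℝ}
    (hg : CSmoothAt g (c t)) (hc : SmoothCurveAt c t) (hv : HasCurveDeriv c v t)
    (ha : HasCurveDeriv (fun s => g (c s)) a t) : a = cdiff g (c t) v := by
  obtain ⟨r, hr, hcr⟩ := hc.exists_taylor_remainder hv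
  have hsmall : (fun n => g (c (t + rapidSeq n ^ 3)) - g (c t + rapidSeq n ^ 3 • v))
      =o[atTop] fun n => rapidSeq n ^ 3 := by
    refine ((hg.isBigO_sub_on_segments (isVonNBounded_range_const v)
      (hr.subset (range_comp_subset_range (fun n => rapidSeq n ^ 3) r))
      (tendsto_rapidSeq_pow (k := 5) (by norm_num))).congr' ?_ .rfl).trans_isLittleO
        (rapidSeq_pow_isLittleO (by norm_num))
    filter_upwards [(tendsto_rapidSeq_pow three_ne_zero).eventually hcr] with n hn
    rw [hn, Function.comp_apply, show (rapidSeq n ^ 3) ^ 2 = rapidSeq n * rapidSeq n ^ 5 by ring]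
  have hline := (hg.hasCurveDeriv_line v).tendsto_rapidSeq
  have hlim := ha.tendsto_rapidSeq.sub hline
  simp only [zero_add, zero_smul, add_zero] at hlim
  refine sub_eq_zero.1 (tendsto_nhds_unique hlim (hsmall.tendsto_inv_smul_nhds_zero.congr
    fun n => ?_))
  rw [← smul_sub, sub_sub_sub_cancel_right]

variable {F : Type*} [AddCommGroup F] [Module ℝ F] [TopologicalSpace F]
  [IsTopologicalAddGroup F] [ContinuousSMul ℝ F] [LocallyConvexSpace ℝ F] [T2Space F]

lemma cdiff_apply_add {f : E → F} {x : E} (hf : CSmoothAt f x) (u v : E) :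
    cdiff f x (u + v) = cdiff f x u + cdiff f x v := by
  refine (SeparatingDual.eq_iff_forall_dual_eq (R := ℝ)).2 fun l => ?_
  rw [map_add, hf.map_cdiff, hf.map_cdiff, hf.map_cdiff]
  have h := (hf.map l).cdiff_midpoint_real ((1 / 2 : ℝ) • (u + v)) ((1 / 2 : ℝ) • (u - v))
  rw [(hf.map l).cdiff_apply_smul, smul_eq_mul, ← smul_add, ← smul_sub, add_add_sub_cancel,
    add_sub_sub_cancel] at h
  simp only [← two_smul ℝ, smul_smul] at h
  norm_num at h
  linarith

lemma hasCurveDeriv_comp [T2Space E] {f : E → F} {c : ℝ → E} {v : E} {t : ℝ}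
    (hf : CSmoothAt f (c t)) (hc : SmoothCurveAt c t) (hv : HasCurveDeriv c v t) :
    HasCurveDeriv (fun s => f (c s)) (cdiff f (c t) v) t := by
  obtain ⟨w, hw⟩ := (hf c t hc rfl).exists_deriv
  suffices w = cdiff f (c t) v from this ▸ hw
  refine (SeparatingDual.eq_iff_forall_dual_eq (R := ℝ)).2 fun l => ?_
  rw [hf.map_cdiff, (hf.map l).eq_cdiff_of_hasCurveDeriv_real hc hv (hw.map l)]

end CSmoothAt

end ChainRule

lemma CSmoothAt.cdiff_comp {E : Type*} [AddCommGroup E] [Module ℝ E] [TopologicalSpace E]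
    [IsTopologicalAddGroup E] [ContinuousSMul ℝ E]
    {F : Type*} [AddCommGroup F] [Module ℝ F] [TopologicalSpace F]
    [IsTopologicalAddGroup F] [ContinuousSMul ℝ F] [LocallyConvexSpace ℝ F] [T2Space F]
    {G : Type*} [AddCommGroup G] [Module ℝ G] [TopologicalSpace G]
    [IsTopologicalAddGroup G] [ContinuousSMul ℝ G] [LocallyConvexSpace ℝ G] [T2Space G]
    {g : F → G} {f : E → F} {x : E} (hg : CSmoothAt g (f x)) (hf : CSmoothAt f x) (v : E) :
    cdiff (fun y => g (f y)) x v = cdiff g (f x) (cdiff f x v) := by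
  have hx : f (x + (0 : ℝ) • v) = f x := by rw [zero_smul, add_zero]
  have h := CSmoothAt.hasCurveDeriv_comp (f := g) (c := fun t : ℝ => f (x + t • v)) (by rwa [hx])
    (hf.smoothCurveAt_line v) (hf.hasCurveDeriv_line v)
  rw [hx] at h
  exact HasCurveDeriv.cdiff_eq (f := fun y => g (f y)) h

/-! ### Symmetry of second derivatives -/

section SecondDerivative

lemma hasFDerivAt_of_continuousAt_partialDeriv {g a b : ℝ × ℝ → ℝ} {p : ℝ × ℝ}
    (ha : ∀ᶠ q in 𝓝 p, HasDerivAt (fun s => g (s, q.2)) (a q) q.1)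
    (hb : ∀ᶠ q in 𝓝 p, HasDerivAt (fun t => g (q.1, t)) (b q) q.2)
    (hac : ContinuousAt a p) (hbc : ContinuousAt b p) :
    HasFDerivAt g (a p • ContinuousLinearMap.fst ℝ ℝ ℝ + b p • ContinuousLinearMap.snd ℝ ℝ ℝ)
      p := by
  have hL : Continuous (ContinuousLinearMap.toSpanSingleton ℝ : ℝ → ℝ →L[ℝ] ℝ) :=
    (ContinuousLinearMap.toSpanSingletonCLE (𝕜 := ℝ) (E := ℝ)).continuous
  have h := hasStrictFDerivAt_uncurry_coprod (u := p) (f := fun s t => g (s, t))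
    (f₁ := fun s t => .toSpanSingleton ℝ (a (s, t)))
    (f₂ := fun s t => .toSpanSingleton ℝ (b (s, t)))
    (ha.mono fun q hq => hq.hasFDerivAt) (hb.mono fun q hq => hq.hasFDerivAt)
    (hL.continuousAt.comp hac) (hL.continuousAt.comp hbc)
  have hL' : a p • ContinuousLinearMap.fst ℝ ℝ ℝ + b p • ContinuousLinearMap.snd ℝ ℝ ℝ =
      (ContinuousLinearMap.toSpanSingleton ℝ (a p)).coprod (.toSpanSingleton ℝ (b p)) := by
    ext <;> simp
  rw [hL']
  exact h.hasFDerivAt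

lemma partialDeriv_symm {g a b a₁ a₂ b₁ b₂ : ℝ × ℝ → ℝ} {p : ℝ × ℝ}
    (ha : ∀ᶠ q in 𝓝 p, HasDerivAt (fun s => g (s, q.2)) (a q) q.1)
    (hb : ∀ᶠ q in 𝓝 p, HasDerivAt (fun t => g (q.1, t)) (b q) q.2)
    (ha₁ : ∀ᶠ q in 𝓝 p, HasDerivAt (fun s => a (s, q.2)) (a₁ q) q.1)
    (ha₂ : ∀ᶠ q in 𝓝 p, HasDerivAt (fun t => a (q.1, t)) (a₂ q) q.2)
    (hb₁ : ∀ᶠ q in 𝓝 p, HasDerivAt (fun s => b (s, q.2)) (b₁ q) q.1)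
    (hb₂ : ∀ᶠ q in 𝓝 p, HasDerivAt (fun t => b (q.1, t)) (b₂ q) q.2)
    (hac : ∀ᶠ q in 𝓝 p, ContinuousAt a q) (hbc : ∀ᶠ q in 𝓝 p, ContinuousAt b q)
    (ha₁c : ContinuousAt a₁ p) (ha₂c : ContinuousAt a₂ p) (hb₁c : ContinuousAt b₁ p)
    (hb₂c : ContinuousAt b₂ p) : a₂ p = b₁ p := by
  have hg : ∀ᶠ q in 𝓝 p, HasFDerivAt g
      (a q • ContinuousLinearMap.fst ℝ ℝ ℝ + b q • ContinuousLinearMap.snd ℝ ℝ ℝ) q := by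
    filter_upwards [ha.eventually_nhds, hb.eventually_nhds, hac, hbc] with q haq hbq hacq hbcq
    exact hasFDerivAt_of_continuousAt_partialDeriv haq hbq hacq hbcq
  have ha' := hasFDerivAt_of_continuousAt_partialDeriv ha₁ ha₂ ha₁c ha₂c
  have hb' := hasFDerivAt_of_continuousAt_partialDeriv hb₁ hb₂ hb₁c hb₂c
  have h := second_derivative_symmetric_of_eventually_of_real hg
    ((ha'.smul_const (ContinuousLinearMap.fst ℝ ℝ ℝ)).add
      (hb'.smul_const (ContinuousLinearMap.snd ℝ ℝ ℝ))) (0, 1) (1, 0)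
  simpa using h

lemma CSmoothAt.continuousAt {E : Type*} [NormedAddCommGroup E] [NormedSpace ℝ E]
    {F : Type*} [AddCommGroup F] [Module ℝ F] [TopologicalSpace F] [IsTopologicalAddGroup F]
    [ContinuousSMul ℝ F] {f : E → F} {x : E} (hf : CSmoothAt f x) : ContinuousAt f x := by
  have h := hf.tendsto.mono_right (curveNhds_le_nhds (f x))
  rwa [curveNhds_eq_nhds] at h

variable {E : Type*} [AddCommGroup E] [Module ℝ E] [TopologicalSpace E]
  [IsTopologicalAddGroup E] [ContinuousSMul ℝ E]

lemma cSmoothAt_plane (x u v : E) (p : ℝ × ℝ) :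
    CSmoothAt (fun q : ℝ × ℝ => x + (q.1 • u + q.2 • v)) p :=
  (CSmoothAt.const x p).add <|
    (((CSmoothAt.id p).map (ContinuousLinearMap.fst ℝ ℝ ℝ)).smul (.const u p)).add
      (((CSmoothAt.id p).map (ContinuousLinearMap.snd ℝ ℝ ℝ)).smul (.const v p))

namespace CSmoothAt

lemma hasDerivAt_plane_left {f : E → ℝ} {x u v : E} {p : ℝ × ℝ}
    (hf : CSmoothAt f (x + (p.1 • u + p.2 • v))) :
    HasDerivAt (fun s : ℝ => f (x + (s • u + p.2 • v)))
      (cdiff f (x + (p.1 • u + p.2 • v)) u) p.1 := by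
  have h := hasCurveDeriv_iff_hasDerivAt.1 (hf.hasCurveDeriv_line u)
  rw [← sub_self p.1] at h
  refine (h.comp_sub_const p.1 p.1).congr_of_eventuallyEq (.of_forall fun _ => congrArg f ?_)
  module

lemma hasDerivAt_plane_right {f : E → ℝ} {x u v : E} {p : ℝ × ℝ}
    (hf : CSmoothAt f (x + (p.1 • u + p.2 • v))) :
    HasDerivAt (fun t : ℝ => f (x + (p.1 • u + t • v)))
      (cdiff f (x + (p.1 • u + p.2 • v)) v) p.2 := by
  have h := hasCurveDeriv_iff_hasDerivAt.1 (hf.hasCurveDeriv_line v)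
  rw [← sub_self p.2] at h
  refine (h.comp_sub_const p.2 p.2).congr_of_eventuallyEq (.of_forall fun _ => congrArg f ?_)
  module

end CSmoothAt

/-- Restricted to a plane, smooth functions are continuous, so this is the symmetry of continuous
second partial derivatives. -/
lemma second_cdiff_symm {V : Set E} (hV : CInftyOpen V) {f : E → ℝ} {x : E} (hx : x ∈ V)
    (hf : ∀ y ∈ V, CSmoothAt f y) (hf' : ∀ y ∈ V, ∀ w, CSmoothAt (fun z => cdiff f z w) y)
    (hf'' : ∀ w w', CSmoothAt (fun z => cdiff (fun y => cdiff f y w) z w') x) (u v : E) :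
    cdiff (fun y => cdiff f y u) x v = cdiff (fun y => cdiff f y v) x u := by
  let φ : ℝ × ℝ → E := fun q => x + (q.1 • u + q.2 • v)
  have hφ (p : ℝ × ℝ) : CSmoothAt φ p := cSmoothAt_plane x u v p
  have hφ0 : φ 0 = x := by simp only [φ, Prod.fst_zero, Prod.snd_zero, zero_smul, add_zero]
  have hφV : ∀ᶠ q in 𝓝 0, φ q ∈ V := by
    rw [← curveNhds_eq_nhds]
    exact (hφ 0).tendsto.eventually (cInftyOpen_iff_mem_curveNhds.1 hV _ (hφ0.symm ▸ hx))
  have hcont' (w : E) : ∀ᶠ p in 𝓝 0, ContinuousAt (fun q => cdiff f (φ q) w) p :=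
    hφV.mono fun p hp => ((hf' _ hp w).comp (hφ p)).continuousAt
  have hcont (w w' : E) :
      ContinuousAt (fun q => cdiff (fun y => cdiff f y w) (φ q) w') 0 :=
    (CSmoothAt.comp (g := fun z => cdiff (fun y => cdiff f y w) z w')
      (hφ0.symm ▸ hf'' w w') (hφ 0)).continuousAt
  have h : cdiff (fun y => cdiff f y u) (φ 0) v = cdiff (fun y => cdiff f y v) (φ 0) u :=
    partialDeriv_symm (g := fun q => f (φ q)) (a := fun q => cdiff f (φ q) u)
      (b := fun q => cdiff f (φ q) v) (hφV.mono fun q hq => (hf _ hq).hasDerivAt_plane_left)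
      (hφV.mono fun q hq => (hf _ hq).hasDerivAt_plane_right)
      (hφV.mono fun q hq => (hf' _ hq u).hasDerivAt_plane_left)
      (hφV.mono fun q hq => (hf' _ hq u).hasDerivAt_plane_right)
      (hφV.mono fun q hq => (hf' _ hq v).hasDerivAt_plane_left)
      (hφV.mono fun q hq => (hf' _ hq v).hasDerivAt_plane_right)
      (hcont' u) (hcont' v) (hcont u u) (hcont u v) (hcont v u) (hcont v v)
  rwa [hφ0] at h

end SecondDerivative

lemma cdiff_const {E F : Type*} [AddCommGroup E] [Module ℝ E] [AddCommGroup F] [Module ℝ F]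
    [TopologicalSpace F] [T2Space F] (a : F) (x v : E) : cdiff (fun _ : E => a) x v = 0 :=
  HasCurveDeriv.cdiff_eq (f := fun _ : E => a) (HasCurveDeriv.const a 0)

lemma cdiff_linearMap {E F : Type*} [AddCommGroup E] [Module ℝ E] [AddCommGroup F] [Module ℝ F]
    [TopologicalSpace F] [IsTopologicalAddGroup F] [ContinuousSMul ℝ F] [T2Space F]
    (L : E →ₗ[ℝ] F) (x v : E) : cdiff L x v = L v := by
  refine HasCurveDeriv.cdiff_eq ?_
  simpa only [map_add, map_smul, zero_add, one_smul, id_eq] using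
    (HasCurveDeriv.const (L x) 0).add (HasCurveDeriv.smul_const (hasDerivAt_id 0) (L v))

section Products

variable {E : Type*} [AddCommGroup E] [Module ℝ E] [TopologicalSpace E]
variable {F : Type*} [AddCommGroup F] [Module ℝ F] [TopologicalSpace F]
variable {G : Type*} [AddCommGroup G] [Module ℝ G] [TopologicalSpace G]

lemma prod_univ_mem_curveNhds {U : Set E} {p : E × F} (hU : U ∈ curveNhds p.1) :
    U ×ˢ univ ∈ curveNhds p := by
  rw [prod_univ]
  exact ((CSmoothAt.id p).map (ContinuousLinearMap.fst ℝ E F)).tendsto hU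

lemma CSmoothOn.cSmoothAt_left [IsTopologicalAddGroup E] [ContinuousSMul ℝ E]
    [IsTopologicalAddGroup F] [ContinuousSMul ℝ F] {U : Set E} {f : E × F → G}
    (hf : CSmoothOn (U ×ˢ univ) f) {x : E} (hU : U ∈ curveNhds x) (u : F) :
    CSmoothAt (fun y => f (y, u)) x :=
  CSmoothAt.comp (f := fun y => (y, u)) (hf.cSmoothAt (prod_univ_mem_curveNhds hU))
    ((CSmoothAt.id x).prodMk (.const u x))

lemma CSmoothAt.cdiff_comp_prodMk [IsTopologicalAddGroup E] [ContinuousSMul ℝ E]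
    [LocallyConvexSpace ℝ E] [T2Space E] [IsTopologicalAddGroup F] [ContinuousSMul ℝ F]
    [LocallyConvexSpace ℝ F] [T2Space F] [IsTopologicalAddGroup G] [ContinuousSMul ℝ G]
    [LocallyConvexSpace ℝ G] [T2Space G] {f : E × F → G} {r : E → F} {x : E}
    (hf : CSmoothAt f (x, r x)) (hr : CSmoothAt r x) (v : E) :
    cdiff (fun y => f (y, r y)) x v =
      cdiff (fun y => f (y, r x)) x v + cdiff (fun u => f (x, u)) (r x) (cdiff r x v) := by
  have hid : cdiff (fun y => y) x v = v := cdiff_linearMap LinearMap.id x v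
  have hgraph : cdiff (fun y => (y, r y)) x v = (v, 0) + (0, cdiff r x v) := by
    have hline := ((CSmoothAt.id x).hasCurveDeriv_line v).prodMk (hr.hasCurveDeriv_line v)
    rw [Prod.mk_add_mk, add_zero, zero_add, HasCurveDeriv.cdiff_eq (f := fun y => (y, r y)) hline,
      hid]
  rw [CSmoothAt.cdiff_comp (f := fun y => (y, r y)) hf ((CSmoothAt.id x).prodMk hr), hgraph,
    hf.cdiff_apply_add]
  simp only [cdiff, Prod.smul_mk, Prod.mk_add_mk, smul_zero, add_zero]

end Products

namespace IsBoundedBilin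

variable {E : Type*} [AddCommGroup E] [Module ℝ E] [TopologicalSpace E]
  [IsTopologicalAddGroup E] [ContinuousSMul ℝ E] [LocallyConvexSpace ℝ E] [T2Space E]
variable {F : Type*} [AddCommGroup F] [Module ℝ F] [TopologicalSpace F]
  [IsTopologicalAddGroup F] [ContinuousSMul ℝ F] [LocallyConvexSpace ℝ F] [T2Space F]
variable {G : Type*} [AddCommGroup G] [Module ℝ G] [TopologicalSpace G]
variable {B : F →ₗ[ℝ] E →ₗ[ℝ] ℝ} {ξ : G → F} {w : G → E} {x : G}

lemma cSmoothAt (hB : IsBoundedBilin B) (hξ : CSmoothAt ξ x) (hw : CSmoothAt w x) :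
    CSmoothAt (fun y => B (ξ y) (w y)) x :=
  fun c t hc ht => hB.smoothCurveAt (hξ c t hc ht) (hw c t hc ht)

lemma cdiff_apply [IsTopologicalAddGroup G] [ContinuousSMul ℝ G] (hB : IsBoundedBilin B)
    (hξ : CSmoothAt ξ x) (hw : CSmoothAt w x) (v : G) :
    cdiff (fun y => B (ξ y) (w y)) x v = B (cdiff ξ x v) (w x) + B (ξ x) (cdiff w x v) := by
  have h := hB.hasCurveDeriv (hξ.smoothCurveAt_line v) (hw.smoothCurveAt_line v)
    (hξ.hasCurveDeriv_line v) (hw.hasCurveDeriv_line v)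
  rw [zero_smul, add_zero] at h
  exact HasCurveDeriv.cdiff_eq (f := fun y => B (ξ y) (w y)) h

end IsBoundedBilin

lemma iteratedCdiff_const {E : Type*} [AddCommGroup E] [Module ℝ E] (a : ℝ) (k : ℕ) (x : E)
    (u : Fin (k + 1) → E) : iteratedCdiff (fun _ : E => a) (k + 1) x u = 0 := by
  induction k generalizing x with
  | zero => exact cdiff_const a x _
  | succ k ih =>
    rw [iteratedCdiff]
    simp only [ih]
    exact cdiff_const 0 x _

/-! ### Manifolds -/

section Manifold

variable {E : Type*} [AddCommGroup E] [Module ℝ E] [TopologicalSpace E]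
variable {M : Type*}

namespace SmoothTransition

variable {e e' : PartialEquiv M E} {y : E}

lemma source_mem_curveNhds (h : SmoothTransition e e') (hy : y ∈ e.target)
    (hy' : e.symm y ∈ e'.source) : (e.symm.trans e').source ∈ curveNhds y :=
  cInftyOpen_iff_mem_curveNhds.1 h.1 y ⟨hy, hy'⟩

lemma eventually_symm_apply_eq (h : SmoothTransition e e') (hy : y ∈ e.target)
    (hy' : e.symm y ∈ e'.source) : ∀ᶠ z in curveNhds y, e'.symm (e' (e.symm z)) = e.symm z := by
  filter_upwards [h.source_mem_curveNhds hy hy'] with z hz using e'.left_inv hz.2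

variable [IsTopologicalAddGroup E] [ContinuousSMul ℝ E]

lemma cSmoothAt (h : SmoothTransition e e') (hy : y ∈ e.target) (hy' : e.symm y ∈ e'.source) :
    CSmoothAt (fun z => e' (e.symm z)) y :=
  h.2.cSmoothAt (h.source_mem_curveNhds hy hy')

lemma cSmoothAt_comp_symm {G : Type*} [AddCommGroup G] [Module ℝ G] [TopologicalSpace G]
    {f : M → G} (h : SmoothTransition e e') (hy : y ∈ e.target) (hy' : e.symm y ∈ e'.source)
    (hf : CSmoothAt (fun z => f (e'.symm z)) (e' (e.symm y))) :
    CSmoothAt (fun z => f (e.symm z)) y :=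
  (CSmoothAt.comp (g := fun z => f (e'.symm z)) (f := fun z => e' (e.symm z)) hf
    (h.cSmoothAt hy hy')).congr <|
      (h.eventually_symm_apply_eq hy hy').mono fun _ hz => congrArg f hz

lemma eventually_symm_mem {U : Set M} (h : SmoothTransition e e') (hy : y ∈ e.target)
    (hy' : e.symm y ∈ e'.source) (hU : ∀ᶠ z in curveNhds (e' (e.symm y)), e'.symm z ∈ U) :
    ∀ᶠ z in curveNhds y, e.symm z ∈ U := by
  filter_upwards [(h.cSmoothAt hy hy').tendsto.eventually hU, h.eventually_symm_apply_eq hy hy']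
    with z hz hze using hze ▸ hz

end SmoothTransition

namespace ConvenientManifold

variable {𝓜 : ConvenientManifold E M} {e e' : PartialEquiv M E} {y : E} {U V : Set M}

lemma target_mem_curveNhds (he : e ∈ 𝓜.maximalAtlas) (hy : y ∈ e.target) :
    e.target ∈ curveNhds y :=
  cInftyOpen_iff_mem_curveNhds.1 he.1 y hy

lemma SmoothFun.mono {f : M → ℝ} (hf : 𝓜.SmoothFun U f) (h : V ⊆ U) : 𝓜.SmoothFun V f :=
  fun e he c hc hcV => hf e he c hc fun t => ⟨(hcV t).1, h (hcV t).2⟩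

lemma IsOpenSet.inter (hU : 𝓜.IsOpenSet U) (hV : 𝓜.IsOpenSet V) : 𝓜.IsOpenSet (U ∩ V) :=
  fun e he c hc => by
    have := (hU e he c hc).inter (hV e he c hc)
    rwa [← preimage_inter, ← inter_inter_distrib_left, ← preimage_inter] at this

variable [IsTopologicalAddGroup E] [ContinuousSMul ℝ E]

lemma IsOpenSet.preimage_mem_curveNhds (hU : 𝓜.IsOpenSet U) (he : e ∈ 𝓜.maximalAtlas)
    (hy : y ∈ e.target ∩ e.symm ⁻¹' U) : e.target ∩ e.symm ⁻¹' U ∈ curveNhds y := by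
  obtain ⟨a, ha, hya⟩ := 𝓜.cover (e.symm y)
  refine inter_mem (target_mem_curveNhds he hy.1)
    ((he.2 a ha).1.eventually_symm_mem hy.1 hya ?_)
  filter_upwards [cInftyOpen_iff_mem_curveNhds.1 (hU a ha) _
    ⟨a.map_source hya, by simpa only [mem_preimage, a.left_inv hya] using hy.2⟩]
    with z hz using hz.2

lemma IsOpenSet.cInftyOpen (hU : 𝓜.IsOpenSet U) (he : e ∈ 𝓜.maximalAtlas) :
    CInftyOpen (e.target ∩ e.symm ⁻¹' U) :=
  cInftyOpen_iff_mem_curveNhds.2 fun _ hy => hU.preimage_mem_curveNhds he hy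

lemma SmoothFun.cSmoothAt {f : M → ℝ} (hf : 𝓜.SmoothFun U f) (hU : 𝓜.IsOpenSet U)
    (he : e ∈ 𝓜.maximalAtlas) (hy : y ∈ e.target ∩ e.symm ⁻¹' U) :
    CSmoothAt (fun z => f (e.symm z)) y := by
  obtain ⟨a, ha, hya⟩ := 𝓜.cover (e.symm y)
  refine (he.2 a ha).1.cSmoothAt_comp_symm hy.1 hya ((hf a ha).cSmoothAt ?_)
  exact cInftyOpen_iff_mem_curveNhds.1 (hU a ha) _
    ⟨a.map_source hya, by simpa only [mem_preimage, a.left_inv hya] using hy.2⟩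

lemma smoothTransition_of_mem_maximalAtlas [T2Space E] (he : e ∈ 𝓜.maximalAtlas)
    (he' : e' ∈ 𝓜.maximalAtlas) : SmoothTransition e e' := by
  have key : ∀ y ∈ (e.symm.trans e').source,
      CSmoothAt (fun z => e' (e.symm z)) y ∧ ∀ᶠ z in curveNhds y, e.symm z ∈ e'.source := by
    intro y hy
    obtain ⟨a, ha, hya⟩ := 𝓜.cover (e.symm y)
    have hae' : a.symm (a (e.symm y)) ∈ e'.source := (a.left_inv hya).symm ▸ hy.2
    have ht := (he'.2 a ha).2
    refine ⟨(he.2 a ha).1.cSmoothAt_comp_symm hy.1 hya (ht.cSmoothAt (a.map_source hya) hae'),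
      (he.2 a ha).1.eventually_symm_mem hy.1 hya ?_⟩
    filter_upwards [ht.source_mem_curveNhds (a.map_source hya) hae'] with z hz using hz.2
  exact ⟨cInftyOpen_iff_mem_curveNhds.2 fun y hy =>
    inter_mem (target_mem_curveNhds he hy.1) (key y hy).2,
    cSmoothOn_of_forall_cSmoothAt fun y hy => (key y hy).1⟩

end ConvenientManifold

end Manifold

/-! ### Weak subbundles in coordinates -/

section Coordinates

variable {E : Type*} [AddCommGroup E] [Module ℝ E] [TopologicalSpace E]
variable {F : Type*} [AddCommGroup F] [Module ℝ F] [TopologicalSpace F]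
variable {M : Type*}

namespace WeakSubbundle

variable {𝓜 : ConvenientManifold E M} (T : WeakSubbundle F 𝓜)

lemma chartAt_mem_charts (x : M) : T.chartAt x ∈ T.charts :=
  (Classical.choose_spec (T.cover x)).1

lemma mem_chartAt_source (x : M) : x ∈ (T.chartAt x).source :=
  (Classical.choose_spec (T.cover x)).2

lemma chartAt_apply_mem_target (x : M) : T.chartAt x x ∈ (T.chartAt x).target :=
  (T.chartAt x).map_source (T.mem_chartAt_source x)

lemma chartAt_symm_apply (x : M) : (T.chartAt x).symm (T.chartAt x x) = x :=
  (T.chartAt x).left_inv (T.mem_chartAt_source x)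

lemma chartAt_apply_mem_preimage {x : M} {U : Set M} (hx : x ∈ U) :
    T.chartAt x x ∈ (T.chartAt x).target ∩ (T.chartAt x).symm ⁻¹' U :=
  ⟨T.chartAt_apply_mem_target x, by rwa [mem_preimage, T.chartAt_symm_apply]⟩

lemma ext_pairing {ξ η : F} (h : ∀ v, T.pairing ξ v = T.pairing η v) : ξ = η :=
  T.pairing_injective (LinearMap.ext h)

lemma pairing_lift {ℓ : E → ℝ} (h : ∃ ξ, ∀ v, T.pairing ξ v = ℓ v) (v : E) :
    T.pairing (T.lift ℓ) v = ℓ v := by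
  obtain ⟨ξ, hξ⟩ := h
  exact congrFun (Function.invFun_eq (f := fun (ξ : F) (v : E) => T.pairing ξ v)
    ⟨ξ, funext hξ⟩) v

lemma isBoundedBilin_pairing : IsBoundedBilin T.pairing := T.pairing_bounded

variable {T} {e e' : PartialEquiv M E} {x : M}

lemma target_mem_curveNhds (he : e ∈ T.charts) {y : E} (hy : y ∈ e.target) :
    e.target ∈ curveNhds y :=
  ConvenientManifold.target_mem_curveNhds (T.charts_subset he) hy

lemma pairing_cotangentOfCoord (he : e ∈ T.charts) (hx : x ∈ e.source) (ξ : F) (v : E) :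
    T.pairing (T.cotangentOfCoord e x ξ) v = T.pairing ξ (T.tangentCoord e x v) := by
  obtain ⟨τ, -, hτ⟩ := T.transition _ (T.chartAt_mem_charts x) e he
  have hy : T.chartAt x x ∈ ((T.chartAt x).symm.trans e).source :=
    T.chartAt_apply_mem_preimage hx
  exact T.pairing_lift ⟨τ (T.chartAt x x, ξ), hτ _ hy ξ⟩ v

lemma isLinearMap_cotangentOfCoord (he : e ∈ T.charts) (hx : x ∈ e.source) :
    IsLinearMap ℝ (T.cotangentOfCoord e x) where
  map_add ξ η := T.ext_pairing fun v => by
    simp only [pairing_cotangentOfCoord he hx, map_add, LinearMap.add_apply]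
  map_smul a ξ := T.ext_pairing fun v => by
    simp only [pairing_cotangentOfCoord he hx, map_smul, LinearMap.smul_apply]

variable [IsTopologicalAddGroup E] [ContinuousSMul ℝ E] [T2Space E]

lemma smoothTransition (he : e ∈ T.charts) (he' : e' ∈ T.charts) : SmoothTransition e e' :=
  ConvenientManifold.smoothTransition_of_mem_maximalAtlas (T.charts_subset he)
    (T.charts_subset he')

lemma cSmoothAt_comp_chartAt_symm (he : e ∈ T.charts) (hx : x ∈ e.source) :
    CSmoothAt (fun z => e ((T.chartAt x).symm z)) (T.chartAt x x) :=
  (smoothTransition (T.chartAt_mem_charts x) he).cSmoothAt (T.chartAt_apply_mem_target x)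
    (by rwa [T.chartAt_symm_apply])

lemma tangentCoord_chartAt (v : E) : T.tangentCoord (T.chartAt x) x v = v := by
  refine (cdiff_congr ?_ v).trans (cdiff_linearMap LinearMap.id _ v)
  filter_upwards [target_mem_curveNhds (T.chartAt_mem_charts x) (T.chartAt_apply_mem_target x)]
    with z hz using (T.chartAt x).right_inv hz

lemma cotangentOfCoord_chartAt (ξ : F) : T.cotangentOfCoord (T.chartAt x) x ξ = ξ :=
  T.ext_pairing fun v => by
    rw [pairing_cotangentOfCoord (T.chartAt_mem_charts x) (T.mem_chartAt_source x),
      tangentCoord_chartAt]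

variable [LocallyConvexSpace ℝ E]

lemma isLinearMap_tangentCoord (he : e ∈ T.charts) (hx : x ∈ e.source) :
    IsLinearMap ℝ (T.tangentCoord e x) where
  map_add := (cSmoothAt_comp_chartAt_symm he hx).cdiff_apply_add
  map_smul := (cSmoothAt_comp_chartAt_symm he hx).cdiff_apply_smul

lemma dfun_eq_cdiff (he : e ∈ T.charts) (hx : x ∈ e.source) {f : M → ℝ}
    (hf : CSmoothAt (fun y => f (e.symm y)) (e x)) (v : E) :
    T.dfun f x v = cdiff (fun y => f (e.symm y)) (e x) (T.tangentCoord e x v) := by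
  have hxe : (T.chartAt x).symm (T.chartAt x x) ∈ e.source := by rwa [T.chartAt_symm_apply]
  have hcomp := CSmoothAt.cdiff_comp (g := fun y => f (e.symm y))
    (f := fun z => e ((T.chartAt x).symm z)) (by rwa [T.chartAt_symm_apply])
    (cSmoothAt_comp_chartAt_symm he hx) v
  rw [T.chartAt_symm_apply] at hcomp
  refine (cdiff_congr ?_ v).trans hcomp
  filter_upwards [(smoothTransition (T.chartAt_mem_charts x) he).eventually_symm_apply_eq
    (T.chartAt_apply_mem_target x) hxe] with z hz using congrArg f hz.symm

end WeakSubbundle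

end Coordinates

/-! ### Functions with differential in the subbundle -/

section Differentials

variable {E : Type*} [AddCommGroup E] [Module ℝ E] [TopologicalSpace E]
variable {F : Type*} [AddCommGroup F] [Module ℝ F] [TopologicalSpace F]
variable {M : Type*} {𝓜 : ConvenientManifold E M}

namespace WeakSubbundle

/-- The expression of the differential of `f` in the chart `e`, as a map into the typical fibre
`F`; it has a meaning only where the derivative of `f ∘ e.symm` is a form in `F`. -/
noncomputable def dflatInChart (T : WeakSubbundle F 𝓜) (e : PartialEquiv M E) (f : M → ℝ)
    (y : E) : F :=
  T.lift (cdiff (fun z => f (e.symm z)) y)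

variable {T : WeakSubbundle F 𝓜} {U V : Set M}

lemma inA_const (a : ℝ) : T.InA U fun _ => a := by
  refine ⟨fun e _ c _ _ => smoothCurve_const a, fun e _ k => ⟨fun _ => 0, fun c _ _ =>
    smoothCurve_const (0 : F), fun y _ u v => ?_⟩⟩
  rw [map_zero, LinearMap.zero_apply]
  exact (iteratedCdiff_const a k y _).symm

namespace InA

variable {f : M → ℝ} {e : PartialEquiv M E} {y : E}

lemma mono (hf : T.InA U f) (h : V ⊆ U) : T.InA V f := by
  refine ⟨hf.1.mono h, fun e he k => ?_⟩
  obtain ⟨G, hG, hG'⟩ := hf.2 e he k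
  exact ⟨G, fun c hc hcV => hG c hc fun t => ⟨⟨(hcV t).1.1, h (hcV t).1.2⟩, mem_univ _⟩,
    fun y hy => hG' y ⟨hy.1, h hy.2⟩⟩

lemma pairing_dflatInChart (hf : T.InA U f) (he : e ∈ T.charts)
    (hy : y ∈ e.target ∩ e.symm ⁻¹' U) (v : E) :
    T.pairing (T.dflatInChart e f y) v = cdiff (fun z => f (e.symm z)) y v := by
  obtain ⟨G, -, hG⟩ := hf.2 e he 0
  exact T.pairing_lift ⟨G (y, Fin.elim0), hG y hy Fin.elim0⟩ v

variable [IsTopologicalAddGroup E] [ContinuousSMul ℝ E]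

lemma eventually_pairing_dflatInChart (hU : 𝓜.IsOpenSet U) (hf : T.InA U f) (he : e ∈ T.charts)
    (hy : y ∈ e.target ∩ e.symm ⁻¹' U) (v : E) : (fun z => T.pairing (T.dflatInChart e f z) v)
      =ᶠ[curveNhds y] fun z => cdiff (fun z => f (e.symm z)) z v := by
  filter_upwards [hU.preimage_mem_curveNhds (T.charts_subset he) hy] with z hz
    using hf.pairing_dflatInChart he hz v

lemma cSmoothAt_dflatInChart (hU : 𝓜.IsOpenSet U) (hf : T.InA U f) (he : e ∈ T.charts)
    (hy : y ∈ e.target ∩ e.symm ⁻¹' U) : CSmoothAt (T.dflatInChart e f) y := by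
  obtain ⟨G, hG, hGf⟩ := hf.2 e he 0
  have hV := hU.preimage_mem_curveNhds (T.charts_subset he) hy
  refine (hG.cSmoothAt_left hV Fin.elim0).congr ?_
  filter_upwards [hV] with z hz
  exact T.ext_pairing fun v =>
    (hGf z hz Fin.elim0 v).trans (hf.pairing_dflatInChart he hz v).symm

variable [LocallyConvexSpace ℝ E] [T2Space E]

lemma pairing_cotangentOfCoord_dflatInChart (hU : 𝓜.IsOpenSet U) (hf : T.InA U f)
    (he : e ∈ T.charts) (hy : y ∈ e.target ∩ e.symm ⁻¹' U) (v : E) :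
    T.pairing (T.cotangentOfCoord e (e.symm y) (T.dflatInChart e f y)) v =
      T.dfun f (e.symm y) v := by
  have hs := e.map_target hy.1
  have hy' : e (e.symm y) = y := e.right_inv hy.1
  have hfe := hf.1.cSmoothAt hU (T.charts_subset he) hy
  rw [pairing_cotangentOfCoord he hs, hf.pairing_dflatInChart he hy,
    dfun_eq_cdiff he hs (hy'.symm ▸ hfe), hy']

lemma dflat_eq_cotangentOfCoord (hU : 𝓜.IsOpenSet U) (hf : T.InA U f) (he : e ∈ T.charts)
    (hy : y ∈ e.target ∩ e.symm ⁻¹' U) :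
    T.dflat f (e.symm y) = T.cotangentOfCoord e (e.symm y) (T.dflatInChart e f y) := by
  have h := hf.pairing_cotangentOfCoord_dflatInChart hU he hy
  exact T.ext_pairing fun v => (T.pairing_lift ⟨_, h⟩ v).trans (h v).symm

lemma pairing_dflat (hU : 𝓜.IsOpenSet U) (hf : T.InA U f) {x : M} (hx : x ∈ U) (v : E) :
    T.pairing (T.dflat f x) v = T.dfun f x v := by
  have h := hf.pairing_cotangentOfCoord_dflatInChart hU (T.chartAt_mem_charts x)
    (T.chartAt_apply_mem_preimage hx)
  rw [T.chartAt_symm_apply] at h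
  exact T.pairing_lift ⟨_, h⟩ v

variable [IsTopologicalAddGroup F] [ContinuousSMul ℝ F] [LocallyConvexSpace ℝ F] [T2Space F]

lemma cSmoothAt_cdiff (hU : 𝓜.IsOpenSet U) (hf : T.InA U f) (he : e ∈ T.charts)
    (hy : y ∈ e.target ∩ e.symm ⁻¹' U) (w : E) :
    CSmoothAt (fun z => cdiff (fun z => f (e.symm z)) z w) y :=
  (T.isBoundedBilin_pairing.cSmoothAt (hf.cSmoothAt_dflatInChart hU he hy) (.const w y)).congr
    (hf.eventually_pairing_dflatInChart hU he hy w)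

lemma cSmoothAt_cdiff_cdiff (hU : 𝓜.IsOpenSet U) (hf : T.InA U f) (he : e ∈ T.charts)
    (hy : y ∈ e.target ∩ e.symm ⁻¹' U) (w w' : E) :
    CSmoothAt (fun z => cdiff (fun z => cdiff (fun z => f (e.symm z)) z w) z w') y := by
  obtain ⟨G, hG, hGf⟩ := hf.2 e he 1
  have hV := hU.preimage_mem_curveNhds (T.charts_subset he) hy
  refine (T.isBoundedBilin_pairing.cSmoothAt (hG.cSmoothAt_left hV fun _ => w)
    (.const w' y)).congr ?_
  filter_upwards [hV] with z hz using hGf z hz (fun _ => w) w'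

lemma pairing_cdiff_dflatInChart (hU : 𝓜.IsOpenSet U) (hf : T.InA U f) (he : e ∈ T.charts)
    (hy : y ∈ e.target ∩ e.symm ⁻¹' U) (u v : E) : T.pairing (cdiff (T.dflatInChart e f) y u) v =
      cdiff (fun z => cdiff (fun z => f (e.symm z)) z v) y u := by
  rw [← cdiff_congr (hf.eventually_pairing_dflatInChart hU he hy v),
    T.isBoundedBilin_pairing.cdiff_apply (hf.cSmoothAt_dflatInChart hU he hy) (.const v y),
    cdiff_const, map_zero, add_zero]

lemma pairing_cdiff_dflatInChart_symm (hU : 𝓜.IsOpenSet U) (hf : T.InA U f)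
    (he : e ∈ T.charts) (hy : y ∈ e.target ∩ e.symm ⁻¹' U) (u v : E) :
    T.pairing (cdiff (T.dflatInChart e f) y u) v =
      T.pairing (cdiff (T.dflatInChart e f) y v) u := by
  have he' := T.charts_subset he
  rw [hf.pairing_cdiff_dflatInChart hU he hy, hf.pairing_cdiff_dflatInChart hU he hy]
  exact second_cdiff_symm (hU.cInftyOpen he') hy
    (fun z hz => hf.1.cSmoothAt hU he' hz) (fun z hz => hf.cSmoothAt_cdiff hU he hz)
    (hf.cSmoothAt_cdiff_cdiff hU he hy) v u

end InA

end WeakSubbundle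

end Differentials

/-! ### Anchors and sections in coordinates -/

section Anchors

variable {E : Type*} [AddCommGroup E] [Module ℝ E] [TopologicalSpace E]
variable {F : Type*} [AddCommGroup F] [Module ℝ F] [TopologicalSpace F]
variable {M : Type*} {𝓜 : ConvenientManifold E M}

namespace WeakSubbundle

/-- The expression in the chart `e` of the anchor `R`, as a family of maps `F → E`. -/
noncomputable def anchorCoord (T : WeakSubbundle F 𝓜) (R : M → F →ₗ[ℝ] E) (e : PartialEquiv M E)
    (y : E) (ξ : F) : E :=
  T.tangentCoord e (e.symm y) (R (e.symm y) (T.cotangentOfCoord e (e.symm y) ξ))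

variable {T : WeakSubbundle F 𝓜} {R P Q : M → F →ₗ[ℝ] E} {e : PartialEquiv M E} {x : M} {y : E}

lemma pairing_anchorCoord (he : e ∈ T.charts) (hy : y ∈ e.target) (ξ η : F) :
    T.pairing (T.cotangentOfCoord e (e.symm y) ξ)
      (R (e.symm y) (T.cotangentOfCoord e (e.symm y) η)) = T.pairing ξ (T.anchorCoord R e y η) :=
  pairing_cotangentOfCoord he (e.map_target hy) _ _

/-- `s : E → F` is the expression of the section `σ` of `T^♭M` near `x` in the chosen chart around
`x`, and it is smooth at `x`. -/
structure HasCoordAt (T : WeakSubbundle F 𝓜) (σ : M → F) (s : E → F) (x : M) : Prop where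
  cSmoothAt : CSmoothAt s (T.chartAt x x)
  eventually_eq : ∀ᶠ y in curveNhds (T.chartAt x x), σ ((T.chartAt x).symm y) =
    T.cotangentOfCoord (T.chartAt x) ((T.chartAt x).symm y) (s y)

section

variable [IsTopologicalAddGroup E] [ContinuousSMul ℝ E] [IsTopologicalAddGroup F]
  [ContinuousSMul ℝ F]

lemma IsAlmostPoissonAnchor.cSmoothAt (hR : T.IsAlmostPoissonAnchor R) (he : e ∈ T.charts)
    (hy : y ∈ e.target) (ξ : F) :
    CSmoothAt (fun p : E × F => T.anchorCoord R e p.1 p.2) (y, ξ) :=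
  (hR.1 e he).cSmoothAt (prod_univ_mem_curveNhds (target_mem_curveNhds he hy))

lemma IsAlmostPoissonAnchor.cSmoothAt_comp (hR : T.IsAlmostPoissonAnchor R) {r : E → F}
    (hr : CSmoothAt r (T.chartAt x x)) :
    CSmoothAt (fun y => T.anchorCoord R (T.chartAt x) y (r y)) (T.chartAt x x) :=
  CSmoothAt.comp (g := fun p : E × F => T.anchorCoord R (T.chartAt x) p.1 p.2)
    (f := fun y => (y, r y))
    (hR.cSmoothAt (T.chartAt_mem_charts x) (T.chartAt_apply_mem_target x) _)
    ((CSmoothAt.id _).prodMk hr)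

lemma HasCoordAt.sum_smul {σ : M → F} {W : Set M} (hW : 𝓜.IsOpenSet W) (hx : x ∈ W)
    {ι : Type*} (t : Finset ι) {a : ι → M → ℝ} {τ : ι → M → F} {u : ι → E → F}
    (ha : ∀ i, 𝓜.SmoothFun W (a i)) (hτ : ∀ i, T.HasCoordAt (τ i) (u i) x)
    (hσ : ∀ y ∈ W, σ y = ∑ i ∈ t, a i y • τ i y) :
    T.HasCoordAt σ (fun y => ∑ i ∈ t, a i ((T.chartAt x).symm y) • u i y) x where
  cSmoothAt := CSmoothAt.sum t fun i _ => ((ha i).cSmoothAt hW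
    (T.charts_subset (T.chartAt_mem_charts x)) (T.chartAt_apply_mem_preimage hx)).smul
      (hτ i).cSmoothAt
  eventually_eq := by
    filter_upwards [hW.preimage_mem_curveNhds (T.charts_subset (T.chartAt_mem_charts x))
      (T.chartAt_apply_mem_preimage hx), (eventually_all_finset t).2 fun i _ =>
        (hτ i).eventually_eq] with y hy hτy
    have hlin := isLinearMap_cotangentOfCoord (T.chartAt_mem_charts x)
      ((T.chartAt x).map_target hy.1)
    rw [hσ _ hy.2, ← hlin.mk'_apply, map_sum]
    refine Finset.sum_congr rfl fun i hi => ?_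
    rw [map_smul, hlin.mk'_apply, hτy i hi]

end

variable [IsTopologicalAddGroup E] [ContinuousSMul ℝ E] [T2Space E]

lemma anchorCoord_chartAt : T.anchorCoord R (T.chartAt x) (T.chartAt x x) = R x := by
  ext ξ
  rw [anchorCoord, T.chartAt_symm_apply, cotangentOfCoord_chartAt, tangentCoord_chartAt]

lemma HasCoordAt.apply_self {σ : M → F} {s : E → F} (hσ : T.HasCoordAt σ s x) :
    s (T.chartAt x x) = σ x := by
  have h := eventually_self_of_curveNhds hσ.eventually_eq
  rwa [T.chartAt_symm_apply, cotangentOfCoord_chartAt, eq_comm] at h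

variable [LocallyConvexSpace ℝ E]

lemma isLinearMap_anchorCoord (he : e ∈ T.charts) (hy : y ∈ e.target) :
    IsLinearMap ℝ (T.anchorCoord R e y) where
  map_add ξ η := by
    rw [anchorCoord, (isLinearMap_cotangentOfCoord he (e.map_target hy)).map_add, map_add,
      (isLinearMap_tangentCoord he (e.map_target hy)).map_add, anchorCoord, anchorCoord]
  map_smul a ξ := by
    rw [anchorCoord, (isLinearMap_cotangentOfCoord he (e.map_target hy)).map_smul, map_smul,
      (isLinearMap_tangentCoord he (e.map_target hy)).map_smul, anchorCoord]

lemma anchorCoord_add (he : e ∈ T.charts) (hy : y ∈ e.target) (ξ : F) :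
    T.anchorCoord (P + Q) e y ξ = T.anchorCoord P e y ξ + T.anchorCoord Q e y ξ :=
  (isLinearMap_tangentCoord he (e.map_target hy)).map_add _ _

lemma HasCoordAt.dflat {U : Set M} (hU : 𝓜.IsOpenSet U) {f : M → ℝ} (hf : T.InA U f)
    (hx : x ∈ U) :
    T.HasCoordAt (T.dflat f) (T.dflatInChart (T.chartAt x) f) x where
  cSmoothAt := hf.cSmoothAt_dflatInChart hU (T.chartAt_mem_charts x)
    (T.chartAt_apply_mem_preimage hx)
  eventually_eq := by
    filter_upwards [hU.preimage_mem_curveNhds (T.charts_subset (T.chartAt_mem_charts x))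
      (T.chartAt_apply_mem_preimage hx)] with y hy
      using hf.dflat_eq_cotangentOfCoord hU (T.chartAt_mem_charts x) hy

namespace IsAlmostPoissonAnchor

lemma add (hP : T.IsAlmostPoissonAnchor P) (hQ : T.IsAlmostPoissonAnchor Q) :
    T.IsAlmostPoissonAnchor (P + Q) := by
  refine ⟨fun e he c hc hcU => ?_, fun x ξ η => ?_⟩
  · have hadd : (fun p : E × F => T.anchorCoord (P + Q) e p.1 p.2) ∘ c = fun t =>
        T.anchorCoord P e (c t).1 (c t).2 + T.anchorCoord Q e (c t).1 (c t).2 :=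
      funext fun t => anchorCoord_add he (hcU t).1 _
    exact hadd ▸ (hP.1 e he c hc hcU).add (hQ.1 e he c hc hcU)
  · simp only [Pi.add_apply, LinearMap.add_apply, map_add, hP.2 x ξ η, hQ.2 x ξ η, neg_add]

variable [IsTopologicalAddGroup F] [ContinuousSMul ℝ F]

/-- The derivative at `x` of the anchor `R`, in the chosen chart around `x`: the bilinear map
`(v, ξ) ↦ (d_xR)(v) ξ`. -/
noncomputable def derivAt (hR : T.IsAlmostPoissonAnchor R) (x : M) : E →ₗ[ℝ] F →ₗ[ℝ] E :=
  have hξ (ξ : F) := hR.cSmoothAt_comp (.const ξ (T.chartAt x x))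
  have hlin : ∀ᶠ z in curveNhds (T.chartAt x x),
      IsLinearMap ℝ (T.anchorCoord R (T.chartAt x) z) :=
    mem_of_superset
      (target_mem_curveNhds (T.chartAt_mem_charts x) (T.chartAt_apply_mem_target x))
      fun _ hz => isLinearMap_anchorCoord (T.chartAt_mem_charts x) hz
  LinearMap.mk₂ ℝ (fun v ξ => cdiff (fun y => T.anchorCoord R (T.chartAt x) y ξ) (T.chartAt x x) v)
    (fun u v ξ => (hξ ξ).cdiff_apply_add u v) (fun a v ξ => (hξ ξ).cdiff_apply_smul a v)
    (fun v ξ η => by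
      rw [← (hξ ξ).cdiff_add (hξ η)]
      exact cdiff_congr (hlin.mono fun z hz => hz.map_add ξ η) v)
    (fun a v ξ => by
      refine (cdiff_congr (hlin.mono fun z hz => hz.map_smul a ξ) v).trans ?_
      exact ((hξ ξ).map_cdiff (a • ContinuousLinearMap.id ℝ E) v).symm)

lemma derivAt_apply (hR : T.IsAlmostPoissonAnchor R) (v : E) (ξ : F) : hR.derivAt x v ξ =
    cdiff (fun y => T.anchorCoord R (T.chartAt x) y ξ) (T.chartAt x x) v := rfl

lemma derivAt_add (hP : T.IsAlmostPoissonAnchor P) (hQ : T.IsAlmostPoissonAnchor Q) :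
    (hP.add hQ).derivAt x = hP.derivAt x + hQ.derivAt x := by
  ext v ξ
  simp only [LinearMap.add_apply, derivAt_apply]
  rw [← (hP.cSmoothAt_comp (.const ξ _)).cdiff_add (hQ.cSmoothAt_comp (.const ξ _))]
  refine cdiff_congr ?_ v
  filter_upwards [target_mem_curveNhds (T.chartAt_mem_charts x) (T.chartAt_apply_mem_target x)]
    with z hz using anchorCoord_add (T.chartAt_mem_charts x) hz ξ

variable [LocallyConvexSpace ℝ F] [T2Space F]

lemma cdiff_comp (hR : T.IsAlmostPoissonAnchor R) {r : E → F} (hr : CSmoothAt r (T.chartAt x x))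
    (v : E) : cdiff (fun y => T.anchorCoord R (T.chartAt x) y (r y)) (T.chartAt x x) v =
      hR.derivAt x v (r (T.chartAt x x)) + R x (cdiff r (T.chartAt x x) v) := by
  have hΦ := hR.cSmoothAt (T.chartAt_mem_charts x) (T.chartAt_apply_mem_target x)
    (r (T.chartAt x x))
  rw [hΦ.cdiff_comp_prodMk hr, derivAt_apply]
  simp only [anchorCoord_chartAt, cdiff_linearMap]

end IsAlmostPoissonAnchor

namespace HasCoordAt

variable {σ ρ : M → F} {s r : E → F}

variable [IsTopologicalAddGroup F] [ContinuousSMul ℝ F] [LocallyConvexSpace ℝ F] [T2Space F]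

lemma cdiff_fieldInChart (hR : T.IsAlmostPoissonAnchor R) (hσ : T.HasCoordAt σ s x) (v : E) :
    cdiff (T.fieldInChart (T.chartAt x) (applySection R σ)) (T.chartAt x x) v =
      hR.derivAt x v (σ x) + R x (cdiff s (T.chartAt x x) v) := by
  rw [← hσ.apply_self, ← hR.cdiff_comp hσ.cSmoothAt]
  refine cdiff_congr ?_ v
  filter_upwards [hσ.eventually_eq] with z hz
  rw [fieldInChart, applySection, hz, anchorCoord]

lemma dfun_pairing (hR : T.IsAlmostPoissonAnchor R) (hσ : T.HasCoordAt σ s x)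
    (hρ : T.HasCoordAt ρ r x) (v : E) :
    T.dfun (fun z => T.pairing (ρ z) (R z (σ z))) x v =
      T.pairing (cdiff r (T.chartAt x x) v) (R x (σ x)) +
        T.pairing (ρ x) (hR.derivAt x v (σ x) + R x (cdiff s (T.chartAt x x) v)) := by
  have hcoord : (fun z => T.pairing (ρ z) (R z (σ z))) ∘ (T.chartAt x).symm
      =ᶠ[curveNhds (T.chartAt x x)]
        fun y => T.pairing (r y) (T.anchorCoord R (T.chartAt x) y (s y)) := by
    filter_upwards [hσ.eventually_eq, hρ.eventually_eq,
      target_mem_curveNhds (T.chartAt_mem_charts x) (T.chartAt_apply_mem_target x)]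
      with y hσy hρy hy
    rw [Function.comp_apply, hσy, hρy, pairing_anchorCoord (T.chartAt_mem_charts x) hy]
  rw [dfun, cdiff_congr hcoord,
    T.isBoundedBilin_pairing.cdiff_apply hρ.cSmoothAt (hR.cSmoothAt_comp hσ.cSmoothAt),
    hR.cdiff_comp hσ.cSmoothAt, anchorCoord_chartAt, hσ.apply_self, hρ.apply_self]

lemma lieDerivative_eq {σ₁ σ₂ σ₃ : M → F} {s₁ s₂ s₃ : E → F} (hP : T.IsAlmostPoissonAnchor P)
    (hQ : T.IsAlmostPoissonAnchor Q) (h₁ : T.HasCoordAt σ₁ s₁ x) (h₂ : T.HasCoordAt σ₂ s₂ x)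
    (h₃ : T.HasCoordAt σ₃ s₃ x) :
    T.lieDerivative (applySection P σ₁) σ₂ (applySection Q σ₃) x =
      T.pairing (cdiff s₂ (T.chartAt x x) (P x (σ₁ x))) (Q x (σ₃ x)) +
        T.pairing (σ₂ x) (hP.derivAt x (Q x (σ₃ x)) (σ₁ x)) +
        T.pairing (σ₂ x) (P x (cdiff s₁ (T.chartAt x x) (Q x (σ₃ x)))) := by
  have hpair := dfun_pairing hQ h₃ h₂ (P x (σ₁ x))
  rw [lieDerivative, lieBracket, h₃.cdiff_fieldInChart hQ, h₁.cdiff_fieldInChart hP]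
  simp only [applySection, hpair, map_add, map_sub]
  ring

end HasCoordAt

end WeakSubbundle

end Anchors

/-! ### The Jacobiator and the Schouten bracket -/

section JacobiForm

variable {k : Type*} [CommSemiring k] {V N : Type*} [AddCommMonoid V] [Module k V]
  [AddCommMonoid N] [Module k N]

/-- The trilinear form `∑_cyc B(ξ₃, D(P ξ₁, ξ₂))`, written as a linear form in `ξ₃`.  For a pairing
`B` and an anchor `P` with derivative `D` at a point, it is the Jacobiator of `P` on covectors. -/
def jacobiForm (B : N →ₗ[k] V →ₗ[k] k) (P : N →ₗ[k] V) (D : V →ₗ[k] N →ₗ[k] V) (ξ₁ ξ₂ : N) :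
    N →ₗ[k] k :=
  B.flip (D (P ξ₁) ξ₂) + B ξ₁ ∘ₗ D (P ξ₂) + B ξ₂ ∘ₗ D.flip ξ₁ ∘ₗ P

lemma jacobiForm_apply (B : N →ₗ[k] V →ₗ[k] k) (P : N →ₗ[k] V) (D : V →ₗ[k] N →ₗ[k] V)
    (ξ₁ ξ₂ ξ₃ : N) : jacobiForm B P D ξ₁ ξ₂ ξ₃ =
      B ξ₃ (D (P ξ₁) ξ₂) + B ξ₁ (D (P ξ₂) ξ₃) + B ξ₂ (D (P ξ₃) ξ₁) := rfl

lemma jacobiForm_cyclic (B : N →ₗ[k] V →ₗ[k] k) (P : N →ₗ[k] V) (D : V →ₗ[k] N →ₗ[k] V)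
    (ξ₁ ξ₂ ξ₃ : N) : jacobiForm B P D ξ₁ ξ₂ ξ₃ = jacobiForm B P D ξ₂ ξ₃ ξ₁ := by
  rw [jacobiForm_apply, jacobiForm_apply]
  ring

lemma eq_zero_of_cyclic_of_mem_span {Φ : N → N → N →ₗ[k] V} (hcyc : ∀ a b c, Φ a b c = Φ b c a)
    {S : Set N} (hΦ : ∀ a ∈ S, ∀ b ∈ S, ∀ c ∈ S, Φ a b c = 0) {a b c : N}
    (ha : a ∈ Submodule.span k S) (hb : b ∈ Submodule.span k S)
    (hc : c ∈ Submodule.span k S) : Φ a b c = 0 := by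
  have hlast (a b : N) (h : ∀ c ∈ S, Φ a b c = 0) : ∀ c ∈ Submodule.span k S, Φ a b c = 0 :=
    LinearMap.eqOn_span (g := 0) h
  refine hlast a b (fun c hc => ?_) c hc
  rw [← hcyc]
  refine hlast c a (fun b hb => ?_) b hb
  rw [← hcyc]
  exact hlast b c (fun a ha => hΦ b hb c hc a ha) a ha

end JacobiForm

section Tensoriality

variable {E : Type*} [AddCommGroup E] [Module ℝ E] [TopologicalSpace E]
variable {F : Type*} [AddCommGroup F] [Module ℝ F] [TopologicalSpace F]
variable {M : Type*} {𝓜 : ConvenientManifold E M}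

namespace WeakSubbundle

/-- The Jacobiator `{f, {g, h}} + {g, {h, f}} + {h, {f, g}}` of the bracket of the anchor `R`. -/
noncomputable def jacobiator (T : WeakSubbundle F 𝓜) (R : M → F →ₗ[ℝ] E) (f g h : M → ℝ) :
    M → ℝ := fun x =>
  T.bracket R f (T.bracket R g h) x + T.bracket R g (T.bracket R h f) x
    + T.bracket R h (T.bracket R f g) x

/-- The values at `x` of the differentials of the functions of class `𝔄` near `x`; they span the
fibre of `𝔓` at `x`. -/
def differentialsAt (T : WeakSubbundle F 𝓜) (x : M) : Set F :=
  {ξ | ∃ (W : Set M) (f : M → ℝ), 𝓜.IsOpenSet W ∧ x ∈ W ∧ T.InA W f ∧ T.dflat f x = ξ}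

variable {T : WeakSubbundle F 𝓜} {R P Q : M → F →ₗ[ℝ] E} {U : Set M} {σ : M → F} {f g h : M → ℝ}
  {x : M}

lemma InA.inP_dflat (hU : 𝓜.IsOpenSet U) (hf : T.InA U f) : T.InP U (T.dflat f) := fun _ hx =>
  ⟨U, hU, hx, Subset.rfl, 1, fun _ _ => 1, fun _ => f, fun _ => inA_const 1, fun _ => hf,
    fun y _ => by simp only [Finset.univ_unique, one_smul, Finset.sum_singleton]⟩

lemma InP.mem_span_differentialsAt (hσ : T.InP U σ) (hx : x ∈ U) :
    σ x ∈ Submodule.span ℝ (T.differentialsAt x) := by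
  obtain ⟨W, hW, hxW, -, n, a, f, -, hf, hσW⟩ := hσ x hx
  rw [hσW x hxW]
  exact Submodule.sum_mem _ fun i _ => Submodule.smul_mem _ _
    (Submodule.subset_span ⟨W, f i, hW, hxW, hf i, rfl⟩)

variable [IsTopologicalAddGroup E] [ContinuousSMul ℝ E] [LocallyConvexSpace ℝ E] [T2Space E]

lemma bracket_eventuallyEq (hU : 𝓜.IsOpenSet U) (hh : T.InA U h) (hx : x ∈ U) :
    T.bracket R g h ∘ (T.chartAt x).symm =ᶠ[curveNhds (T.chartAt x x)]
      (fun z => T.pairing (T.dflat h z) (R z (T.dflat g z))) ∘ (T.chartAt x).symm := by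
  filter_upwards [hU.preimage_mem_curveNhds (T.charts_subset (T.chartAt_mem_charts x))
    (T.chartAt_apply_mem_preimage hx)] with y hy using (hh.pairing_dflat hU hy.2 _).symm

variable [IsTopologicalAddGroup F] [ContinuousSMul ℝ F]

lemma InP.exists_hasCoordAt (hσ : T.InP U σ) (hx : x ∈ U) : ∃ s, T.HasCoordAt σ s x := by
  obtain ⟨W, hW, hxW, -, n, a, f, ha, hf, hσW⟩ := hσ x hx
  exact ⟨_, .sum_smul hW hxW Finset.univ (fun i => (ha i).1)
    (fun i => HasCoordAt.dflat hW (hf i) hxW) hσW⟩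

variable [LocallyConvexSpace ℝ F] [T2Space F]

/-- The terms with derivatives of the coordinate expressions of the `σᵢ` cancel in pairs, by
antisymmetry of the anchors. -/
lemma schouten_eq_jacobiForm (hP : T.IsAlmostPoissonAnchor P) (hQ : T.IsAlmostPoissonAnchor Q)
    {σ₁ σ₂ σ₃ : M → F} {s₁ s₂ s₃ : E → F} (h₁ : T.HasCoordAt σ₁ s₁ x)
    (h₂ : T.HasCoordAt σ₂ s₂ x) (h₃ : T.HasCoordAt σ₃ s₃ x) :
    T.schouten P Q σ₁ σ₂ σ₃ x =
      jacobiForm T.pairing (Q x) (hP.derivAt x) (σ₁ x) (σ₂ x) (σ₃ x) +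
        jacobiForm T.pairing (P x) (hQ.derivAt x) (σ₁ x) (σ₂ x) (σ₃ x) := by
  simp only [schouten, schoutenTerm, jacobiForm_apply,
    HasCoordAt.lieDerivative_eq hP hQ h₁ h₂ h₃, HasCoordAt.lieDerivative_eq hP hQ h₂ h₃ h₁,
    HasCoordAt.lieDerivative_eq hP hQ h₃ h₁ h₂, HasCoordAt.lieDerivative_eq hQ hP h₁ h₂ h₃,
    HasCoordAt.lieDerivative_eq hQ hP h₂ h₃ h₁, HasCoordAt.lieDerivative_eq hQ hP h₃ h₁ h₂]
  simp only [hP.2 x _ (cdiff _ _ _), hQ.2 x _ (cdiff _ _ _)]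
  ring

lemma bracket_bracket_eq (hR : T.IsAlmostPoissonAnchor R) (hU : 𝓜.IsOpenSet U) (f : M → ℝ)
    (hg : T.InA U g) (hh : T.InA U h) (hx : x ∈ U) :
    T.bracket R f (T.bracket R g h) x =
      T.pairing (cdiff (T.dflatInChart (T.chartAt x) h) (T.chartAt x x) (R x (T.dflat f x)))
          (R x (T.dflat g x)) +
        T.pairing (T.dflat h x) (hR.derivAt x (R x (T.dflat f x)) (T.dflat g x)) -
        T.pairing (cdiff (T.dflatInChart (T.chartAt x) g) (T.chartAt x x) (R x (T.dflat f x)))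
          (R x (T.dflat h x)) := by
  rw [bracket, dfun, cdiff_congr (bracket_eventuallyEq hU hh hx)]
  refine (HasCoordAt.dfun_pairing hR (.dflat hU hg hx) (.dflat hU hh hx) _).trans ?_
  rw [map_add, hR.2 x _ (cdiff _ _ _)]
  ring

/-- The second derivatives of `f`, `g` and `h` cancel in pairs, by symmetry. -/
lemma jacobiator_eq_jacobiForm (hR : T.IsAlmostPoissonAnchor R) (hU : 𝓜.IsOpenSet U)
    (hf : T.InA U f) (hg : T.InA U g) (hh : T.InA U h) (hx : x ∈ U) :
    T.jacobiator R f g h x =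
      jacobiForm T.pairing (R x) (hR.derivAt x) (T.dflat f x) (T.dflat g x) (T.dflat h x) := by
  have hsymm {f : M → ℝ} (hf : T.InA U f) := hf.pairing_cdiff_dflatInChart_symm hU
    (T.chartAt_mem_charts x) (T.chartAt_apply_mem_preimage hx)
  rw [jacobiator, bracket_bracket_eq hR hU f hg hh hx, bracket_bracket_eq hR hU g hh hf hx,
    bracket_bracket_eq hR hU h hf hg hx, hsymm hh (R x (T.dflat f x)),
    hsymm hg (R x (T.dflat f x)), hsymm hf (R x (T.dflat g x)), jacobiForm_apply]
  ring

lemma jacobiator_add (hP : T.IsAlmostPoissonAnchor P) (hQ : T.IsAlmostPoissonAnchor Q)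
    (hU : 𝓜.IsOpenSet U) (hf : T.InA U f) (hg : T.InA U g) (hh : T.InA U h) (hx : x ∈ U) :
    T.jacobiator (P + Q) f g h x = T.jacobiator P f g h x + T.jacobiator Q f g h x +
      T.schouten P Q (T.dflat f) (T.dflat g) (T.dflat h) x := by
  rw [jacobiator_eq_jacobiForm (hP.add hQ) hU hf hg hh hx,
    jacobiator_eq_jacobiForm hP hU hf hg hh hx, jacobiator_eq_jacobiForm hQ hU hf hg hh hx,
    schouten_eq_jacobiForm hP hQ (.dflat hU hf hx) (.dflat hU hg hx) (.dflat hU hh hx)]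
  simp only [jacobiForm_apply, hP.derivAt_add hQ, Pi.add_apply, LinearMap.add_apply, map_add]
  ring

lemma schoutenVanishes_iff (hP : T.IsAlmostPoissonAnchor P) (hQ : T.IsAlmostPoissonAnchor Q) :
    T.SchoutenVanishes P Q ↔ ∀ U, 𝓜.IsOpenSet U → ∀ f g h, T.InA U f → T.InA U g → T.InA U h →
      ∀ x ∈ U, T.schouten P Q (T.dflat f) (T.dflat g) (T.dflat h) x = 0 := by
  refine ⟨fun H U hU f g h hf hg hh => H U hU _ _ _ (hf.inP_dflat hU) (hg.inP_dflat hU)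
    (hh.inP_dflat hU), fun H U _ σ₁ σ₂ σ₃ h₁ h₂ h₃ x hx => ?_⟩
  obtain ⟨s₁, c₁⟩ := h₁.exists_hasCoordAt hx
  obtain ⟨s₂, c₂⟩ := h₂.exists_hasCoordAt hx
  obtain ⟨s₃, c₃⟩ := h₃.exists_hasCoordAt hx
  rw [schouten_eq_jacobiForm hP hQ c₁ c₂ c₃]
  refine eq_zero_of_cyclic_of_mem_span
    (Φ := fun a b => jacobiForm T.pairing (Q x) (hP.derivAt x) a b +
      jacobiForm T.pairing (P x) (hQ.derivAt x) a b)
    (fun a b c => by simp only [LinearMap.add_apply, jacobiForm_cyclic _ _ _ a b c]) ?_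
    (h₁.mem_span_differentialsAt hx) (h₂.mem_span_differentialsAt hx)
    (h₃.mem_span_differentialsAt hx)
  rintro _ ⟨W₁, f, hW₁, hx₁, hf, rfl⟩ _ ⟨W₂, g, hW₂, hx₂, hg, rfl⟩ _ ⟨W₃, h, hW₃, hx₃, hh, rfl⟩
  rw [LinearMap.add_apply, ← schouten_eq_jacobiForm hP hQ (.dflat hW₁ hf hx₁) (.dflat hW₂ hg hx₂)
    (.dflat hW₃ hh hx₃)]
  exact H _ ((hW₁.inter hW₂).inter hW₃) f g h (hf.mono fun _ hz => hz.1.1)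
    (hg.mono fun _ hz => hz.1.2) (hh.mono fun _ hz => hz.2) x ⟨⟨hx₁, hx₂⟩, hx₃⟩

end WeakSubbundle

end Tensoriality

theorem mainTheorem1_general
    {E : Type*} [AddCommGroup E] [Module ℝ E] [TopologicalSpace E] [IsTopologicalAddGroup E]
    [ContinuousSMul ℝ E] [LocallyConvexSpace ℝ E] [T2Space E]
    {F : Type*} [AddCommGroup F] [Module ℝ F] [TopologicalSpace F] [IsTopologicalAddGroup F]
    [ContinuousSMul ℝ F] [LocallyConvexSpace ℝ F] [T2Space F]
    {M : Type*} (𝓜 : ConvenientManifold E M) (T : WeakSubbundle F 𝓜)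
    (P Q : M → F →ₗ[ℝ] E)
    (hP : T.IsPartialPoissonAnchor P) (hQ : T.IsPartialPoissonAnchor Q) :
    T.Compatible P Q ↔ T.SchoutenVanishes P Q := by
  have hadd {U f g h x} (hU : 𝓜.IsOpenSet U) (hf : T.InA U f) (hg : T.InA U g) (hh : T.InA U h)
      (hx : x ∈ U) : T.jacobiator (P + Q) f g h x =
        T.schouten P Q (T.dflat f) (T.dflat g) (T.dflat h) x := by
    have hJP : T.jacobiator P f g h x = 0 := hP.2 U hU f g h hf hg hh x hx
    have hJQ : T.jacobiator Q f g h x = 0 := hQ.2 U hU f g h hf hg hh x hx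
    rw [WeakSubbundle.jacobiator_add hP.1 hQ.1 hU hf hg hh hx, hJP, hJQ, zero_add, zero_add]
  rw [WeakSubbundle.schoutenVanishes_iff hP.1 hQ.1]
  exact ⟨fun H U hU f g h hf hg hh x hx =>
      (hadd hU hf hg hh hx).symm.trans (H.2 U hU f g h hf hg hh x hx),
    fun H => ⟨hP.1.add hQ.1, fun U hU f g h hf hg hh x hx =>
      (hadd hU hf hg hh hx).trans (H U hU f g h hf hg hh x hx)⟩⟩

theorem mainTheorem1
    {E : Type*} [AddCommGroup E] [Module ℝ E] [TopologicalSpace E] [ConvenientSpace E]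
    {F : Type*} [AddCommGroup F] [Module ℝ F] [TopologicalSpace F] [ConvenientSpace F]
    {M : Type*} (𝓜 : ConvenientManifold E M) (T : WeakSubbundle F 𝓜)
    (P Q : M → F →ₗ[ℝ] E)
    (hP : T.IsPartialPoissonAnchor P) (hQ : T.IsPartialPoissonAnchor Q) :
    T.Compatible P Q ↔ T.SchoutenVanishes P Q :=
  mainTheorem1_general 𝓜 T P Q hP hQ
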